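/- Let $G=(V,E)$ be a finite simple undirected graph with $n\ge 1$ vertices. A *Customizable Hub Labeling* (CuHL) of $G$ is a map $L\colon V\to 2^V$ such that for all $s,t\in V$ (including $s=t$) and every $s$-$t$-path $P$ in $G$, the set $L(s)\cap L(t)$ contains a vertex of $P$. It is *hierarchical* (an HCuHL) if there is a bijection $\pi\colon V\to\{1,\dots,n\}$ such that $u\in L(v)$ implies $\pi(u)\ge\pi(v)$. The average label size of $L$ is $L_{\mathrm{avg}}=\frac1n\sum_{v\in V}|L(v)|$. A $\sqrt n\times\sqrt n$ grid graph is a graph isomorphic to the Cartesian product of two paths with $k=\sqrt n\ge 1$ vertices each. **Lemma.** There is an algorithm that, given any $\sqrt n\times\sqrt n$ grid graph $G$ (by its number of vertices and its adjacency matrix, with the vertices numbered arbitrarily), computes in time polynomial in $n$ an HCuHL of $G$ whose average label size is at most $$\frac{3}{\frac14\cdot\sqrt{2/3}}\approx 14.7$$ times the average label size of any CuHL of $G$, and at most $$\frac{3}{\frac23\cdot\sqrt{2/3}}\approx 5.5$$ times the average label size of any HCuHL of $G$. -/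

import Mathlib

namespace CuHL

/-- Customizable cover property: for all vertices `s`, `t` (also `s = t`) and every `s`-`t`-path `P`,
the set `L s ∩ L t` contains a vertex of `P`. -/
def IsCuHL {V : Type*} (G : SimpleGraph V) (L : V → Finset V) : Prop :=
  ∀ (s t : V) (P : G.Walk s t), P.IsPath → ∃ w ∈ P.support, w ∈ L s ∧ w ∈ L t

/-- `L` respects the vertex order `π`: a label only contains vertices of at least the same rank. -/
def Respects {V : Type*} [Fintype V] (L : V → Finset V) (π : V ≃ Fin (Fintype.card V)) : Prop :=
  ∀ u v : V, u ∈ L v → π v ≤ π u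

/-- A hierarchical customizable hub labeling. -/
def IsHCuHL {V : Type*} [Fintype V] (G : SimpleGraph V) (L : V → Finset V) : Prop :=
  IsCuHL G L ∧ ∃ π : V ≃ Fin (Fintype.card V), Respects L π

/-- The average label size of a labeling. -/
noncomputable def avgLabelSize {V : Type*} [Fintype V] (L : V → Finset V) : ℝ :=
  (∑ v, ((L v).card : ℝ)) / Fintype.card V

/-- The `k × k` grid: `(i, j)` and `(i', j')` are adjacent iff they agree in one coordinate and
differ by exactly one in the other. -/
def gridGraph (k : ℕ) : SimpleGraph (Fin k × Fin k) :=
  (SimpleGraph.pathGraph k).boxProd (SimpleGraph.pathGraph k)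

/-- `G` is a `√n × √n` grid graph, where `n` is its number of vertices and the vertices may be
numbered in any way. -/
def IsSquareGrid {V : Type*} (G : SimpleGraph V) : Prop :=
  ∃ k : ℕ, Nonempty (G ≃g gridGraph k)

/-! The machine model: a random access machine in structured form. A program uses finitely many
variables and finitely many two-dimensional arrays, all holding natural numbers. Every operation
(access to a variable or an array cell, addition, truncated subtraction, halving, comparison,
assignment, test) costs one step. As there is no multiplication, the bit lengths of the numbers grow
by at most a constant per step, so that polynomial time is the same notion as for Turing machines. -/

/-- The contents of the memory. -/
structure Store where
  /-- the value of each variable -/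
  var : ℕ → ℕ
  /-- the entry of array `a` at row `i` and column `j` is `arr a i j` -/
  arr : ℕ → ℕ → ℕ → ℕ

/-- Expressions; comparisons have the values `1` (true) and `0` (false). -/
inductive Expr where
  | const (c : ℕ)
  | var (x : ℕ)
  | get (a : ℕ) (i j : Expr)
  | add (e f : Expr)
  | sub (e f : Expr)
  | half (e : Expr)
  | lt (e f : Expr)
  | eq (e f : Expr)

/-- The value of an expression. -/
def Expr.eval (σ : Store) : Expr → ℕ
  | .const c => c
  | .var x => σ.var x
  | .get a i j => σ.arr a (i.eval σ) (j.eval σ)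
  | .add e f => e.eval σ + f.eval σ
  | .sub e f => e.eval σ - f.eval σ
  | .half e => e.eval σ / 2
  | .lt e f => if e.eval σ < f.eval σ then 1 else 0
  | .eq e f => if e.eval σ = f.eval σ then 1 else 0

/-- The number of steps for the evaluation of an expression. -/
def Expr.cost : Expr → ℕ
  | .const _ => 1
  | .var _ => 1
  | .get _ i j => i.cost + j.cost + 1
  | .add e f => e.cost + f.cost + 1
  | .sub e f => e.cost + f.cost + 1
  | .half e => e.cost + 1
  | .lt e f => e.cost + f.cost + 1
  | .eq e f => e.cost + f.cost + 1

/-- Programs. -/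
inductive Prog where
  | skip
  | assign (x : ℕ) (e : Expr)
  | store (a : ℕ) (i j e : Expr)
  | seq (p q : Prog)
  | ite (e : Expr) (p q : Prog)
  | loop (e : Expr) (p : Prog)

/-- The store after the assignment of `m` to the variable `x`. -/
def Store.setVar (σ : Store) (x m : ℕ) : Store :=
  { σ with var := fun y => if y = x then m else σ.var y }

/-- The store after the assignment of `m` to the entry `(i, j)` of the array `a`. -/
def Store.setArr (σ : Store) (a i j m : ℕ) : Store :=
  { σ with arr := fun b i' j' => if b = a ∧ i' = i ∧ j' = j then m else σ.arr b i' j' }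

/-- `Run p σ t τ`: started in the store `σ`, the program `p` halts after exactly `t` steps in the
store `τ`. The statement `loop e p` repeats `p` as long as `e` is not `0`. -/
inductive Run : Prog → Store → ℕ → Store → Prop where
  | skip (σ : Store) : Run .skip σ 1 σ
  | assign (σ : Store) (x : ℕ) (e : Expr) :
      Run (.assign x e) σ (e.cost + 1) (σ.setVar x (e.eval σ))
  | store (σ : Store) (a : ℕ) (i j e : Expr) :
      Run (.store a i j e) σ (i.cost + j.cost + e.cost + 1)
        (σ.setArr a (i.eval σ) (j.eval σ) (e.eval σ))
  | seq {σ τ ρ : Store} {p q : Prog} {t u : ℕ} :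
      Run p σ t τ → Run q τ u ρ → Run (.seq p q) σ (t + u) ρ
  | iteTrue {σ τ : Store} {e : Expr} {p q : Prog} {t : ℕ} :
      e.eval σ ≠ 0 → Run p σ t τ → Run (.ite e p q) σ (e.cost + 1 + t) τ
  | iteFalse {σ τ : Store} {e : Expr} {p q : Prog} {t : ℕ} :
      e.eval σ = 0 → Run q σ t τ → Run (.ite e p q) σ (e.cost + 1 + t) τ
  | loopDone {σ : Store} {e : Expr} {p : Prog} :
      e.eval σ = 0 → Run (.loop e p) σ (e.cost + 1) σ
  | loopStep {σ τ ρ : Store} {e : Expr} {p : Prog} {t u : ℕ} :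
      e.eval σ ≠ 0 → Run p σ t τ → Run (.loop e p) τ u ρ →
        Run (.loop e p) σ (e.cost + 1 + t + u) ρ

open Classical in
/-- The input: variable `0` holds the number of vertices and array `0` holds the adjacency matrix
of `G`; everything else is `0`. -/
noncomputable def inputStore {n : ℕ} (G : SimpleGraph (Fin n)) : Store where
  var := fun x => if x = 0 then n else 0
  arr := fun a i j =>
    if a = 0 ∧ ∃ (hi : i < n) (hj : j < n), G.Adj ⟨i, hi⟩ ⟨j, hj⟩ then 1 else 0

/-- The output: `u` is in the label of `v` iff the entry of array `1` in row `v` and column `u`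
is not `0`. -/
def outputLabeling (n : ℕ) (σ : Store) : Fin n → Finset (Fin n) :=
  fun v => Finset.univ.filter fun u : Fin n => σ.arr 1 v u ≠ 0

end CuHL

namespace CuHL

/-! The labeling comes from nested dissection and has at most `3 * k` hubs per vertex. Every
customizable hub labeling of the grid, hierarchical or not, has average size at least `(2 / 3) * √(2
/ 3) * k`. This one lower bound gives both ratios, because `1 / 4 ≤ 2 / 3`.

Lower bound. If `s` lies outside `shadow (L t)`, its row or its column avoids `L t`; likewise for
`t` and `L s`. Two such lines cross, or are parallel and can be joined by a perpendicular line
avoiding `L s` when `L s` has fewer than `k` elements. The resulting walk misses `L s ∩ L t`, so one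
of the two vertices must lie in the other's shadow (`mem_shadow_or_of_isCuHL`). A shadow has at most
the square of the label size many vertices. Counting pairs therefore bounds how many labels can be
small (`sq_card_le_two_mul_sum_sq`), and a threshold at `√(2 / 3) * k` turns this into the average.

Upper bound. The middle column separates a rectangle. A path meeting it has its topmost vertex there
as a common hub; any other path stays on one side (`exists_hub_of_connected`). Directions alternate,
so the separator lengths add up geometrically (`card_hub_le`).

Algorithm. Breadth-first searches give all distances. Distances to two corners of one side determine
the coordinates up to a symmetry of the square (`GridMatrix.cornerXY_eq`), and the dissection
recursion is then run for each pair of vertices. All running times are explicit polynomials. -/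

/-! ### Lower bound for all customizable hub labelings of a grid -/

/-- `a` and `b` are joined by a walk that avoids `S`. -/
def AvoidConn {V : Type*} (G : SimpleGraph V) (S : Set V) (a b : V) : Prop :=
  ∃ w : G.Walk a b, ∀ v ∈ w.support, v ∉ S

theorem AvoidConn.trans {V : Type*} {G : SimpleGraph V} {S : Set V} {a b c : V}
    (h : AvoidConn G S a b) (h' : AvoidConn G S b c) : AvoidConn G S a c := by
  obtain ⟨w, hw⟩ := h
  obtain ⟨w', hw'⟩ := h'
  refine ⟨w.append w', fun v hv => ?_⟩
  rcases (SimpleGraph.Walk.mem_support_append_iff w w').1 hv with h | h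
  · exact hw v h
  · exact hw' v h

/-- Shortcutting a walk to a path only removes vertices, so the cover property also controls walks.
This permits gluing line segments without checking for repetitions. -/
theorem IsCuHL.not_avoidConn {V : Type*} {G : SimpleGraph V} {L : V → Finset V}
    (hL : IsCuHL G L) (s t : V) : ¬ AvoidConn G {v | v ∈ L s ∧ v ∈ L t} s t := by
  classical
  rintro ⟨w, hw⟩
  obtain ⟨v, hv, h⟩ := hL s t w.bypass w.bypass_isPath
  exact hw v (w.support_bypass_subset_support hv) h

theorem avoidConn_map {V W : Type*} {G : SimpleGraph V} {H : SimpleGraph W} {S : Set W}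
    (f : G →g H) (h : ∀ v, f v ∉ S) {a b : V} (w : G.Walk a b) : AvoidConn H S (f a) (f b) := by
  refine ⟨w.map f, fun v hv => ?_⟩
  rw [SimpleGraph.Walk.support_map] at hv
  obtain ⟨i, -, rfl⟩ := List.mem_map.1 hv
  exact h i

theorem avoidConn_row {k : ℕ} {S : Set (Fin k × Fin k)} {j : Fin k}
    (h : ∀ i, (i, j) ∉ S) (a b : Fin k) : AvoidConn (gridGraph k) S (a, j) (b, j) := by
  obtain ⟨w⟩ := SimpleGraph.pathGraph_preconnected k a b
  exact avoidConn_map (SimpleGraph.boxProdLeft _ (SimpleGraph.pathGraph k) j).toHom h w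

theorem avoidConn_col {k : ℕ} {S : Set (Fin k × Fin k)} {i : Fin k}
    (h : ∀ j, (i, j) ∉ S) (a b : Fin k) : AvoidConn (gridGraph k) S (i, a) (i, b) := by
  obtain ⟨w⟩ := SimpleGraph.pathGraph_preconnected k a b
  exact avoidConn_map (SimpleGraph.boxProdRight (SimpleGraph.pathGraph k) _ i).toHom h w

/-- The vertices whose row and column both meet `A`. -/
def shadow {k : ℕ} (A : Finset (Fin k × Fin k)) : Finset (Fin k × Fin k) :=
  A.image Prod.fst ×ˢ A.image Prod.snd

theorem card_shadow_le {k : ℕ} (A : Finset (Fin k × Fin k)) : (shadow A).card ≤ A.card ^ 2 := by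
  rw [shadow, Finset.card_product, sq]
  exact Nat.mul_le_mul Finset.card_image_le Finset.card_image_le

theorem free_of_notMem_shadow {k : ℕ} {A : Finset (Fin k × Fin k)} {v : Fin k × Fin k}
    (h : v ∉ shadow A) : (∀ j, (v.1, j) ∉ A) ∨ ∀ i, (i, v.2) ∉ A := by
  by_contra! hc
  obtain ⟨⟨j, hj⟩, i, hi⟩ := hc
  exact h (Finset.mem_product.2
    ⟨Finset.mem_image.2 ⟨_, hj, rfl⟩, Finset.mem_image.2 ⟨_, hi, rfl⟩⟩)

theorem exists_free_col {k : ℕ} {A : Finset (Fin k × Fin k)} (h : A.card < k) :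
    ∃ i, ∀ j, (i, j) ∉ A := by
  by_contra! hc
  have : (Finset.univ : Finset (Fin k)) ⊆ A.image Prod.fst := fun i _ => by
    obtain ⟨j, hj⟩ := hc i
    exact Finset.mem_image.2 ⟨_, hj, rfl⟩
  have := (Finset.card_le_card this).trans Finset.card_image_le
  simp at this
  omega

theorem exists_free_row {k : ℕ} {A : Finset (Fin k × Fin k)} (h : A.card < k) :
    ∃ j, ∀ i, (i, j) ∉ A := by
  by_contra! hc
  have : (Finset.univ : Finset (Fin k)) ⊆ A.image Prod.snd := fun i _ => by
    obtain ⟨j, hj⟩ := hc i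
    exact Finset.mem_image.2 ⟨_, hj, rfl⟩
  have := (Finset.card_le_card this).trans Finset.card_image_le
  simp at this
  omega

/-- Otherwise a line through `s` avoids `L t` and a line through `t` avoids `L s`. If they are
perpendicular they meet; if parallel, the bound on `L s` leaves a perpendicular line free of `L s`
to connect them. Each segment avoids one of the two labels, hence their intersection. -/
theorem mem_shadow_or_of_isCuHL {k : ℕ} {L : Fin k × Fin k → Finset (Fin k × Fin k)}
    (hL : IsCuHL (gridGraph k) L) {s t : Fin k × Fin k} (hs : (L s).card < k) :
    s ∈ shadow (L t) ∨ t ∈ shadow (L s) := by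
  by_contra! hc
  refine hL.not_avoidConn s t ?_
  set S : Set (Fin k × Fin k) := {v | v ∈ L s ∧ v ∈ L t}
  obtain ⟨s1, s2⟩ := s
  obtain ⟨t1, t2⟩ := t
  rcases free_of_notMem_shadow hc.1 with h1 | h1 <;>
    rcases free_of_notMem_shadow hc.2 with h2 | h2
  · obtain ⟨j, hj⟩ := exists_free_row hs
    exact (avoidConn_col (fun _ h => h1 _ h.2) s2 j).trans
      ((avoidConn_row (fun _ h => hj _ h.1) s1 t1).trans
        (avoidConn_col (fun _ h => h2 _ h.1) j t2))
  · exact (avoidConn_col (fun _ h => h1 _ h.2) s2 t2).trans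
      (avoidConn_row (fun _ h => h2 _ h.1) s1 t1)
  · exact (avoidConn_row (fun _ h => h1 _ h.2) s1 t1).trans
      (avoidConn_col (fun _ h => h2 _ h.1) s2 t2)
  · obtain ⟨i, hi⟩ := exists_free_col hs
    exact (avoidConn_row (fun _ h => h1 _ h.2) s1 i).trans
      ((avoidConn_col (fun _ h => hi _ h.1) s2 t2).trans
        (avoidConn_row (fun _ h => h2 _ h.1) i t1))

/-- Each ordered pair from `A` is charged to a shadow containing one of its members. Each vertex
receives at most the size of its shadow in each of the two roles. -/
theorem sq_card_le_two_mul_sum_sq {k : ℕ} {L : Fin k × Fin k → Finset (Fin k × Fin k)}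
    (hL : IsCuHL (gridGraph k) L) (A : Finset (Fin k × Fin k)) (hA : ∀ t ∈ A, (L t).card < k) :
    A.card ^ 2 ≤ 2 * ∑ t ∈ A, (L t).card ^ 2 := by
  classical
  have key : A ×ˢ A ⊆ (A ×ˢ A).filter (fun p => p.1 ∈ shadow (L p.2)) ∪
      (A ×ˢ A).filter (fun p => p.2 ∈ shadow (L p.1)) := by
    intro p hp
    have hp' := Finset.mem_product.1 hp
    rcases mem_shadow_or_of_isCuHL hL (t := p.2) (hA p.1 hp'.1) with h | h
    · exact Finset.mem_union_left _ (Finset.mem_filter.2 ⟨hp, h⟩)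
    · exact Finset.mem_union_right _ (Finset.mem_filter.2 ⟨hp, h⟩)
  have hle (t : Fin k × Fin k) : (A.filter fun v => v ∈ shadow (L t)).card ≤ (L t).card ^ 2 := by
    refine le_trans (Finset.card_le_card ?_) (card_shadow_le (L t))
    intro v hv
    exact (Finset.mem_filter.1 hv).2
  have h1 : ((A ×ˢ A).filter (fun p => p.1 ∈ shadow (L p.2))).card ≤ ∑ t ∈ A, (L t).card ^ 2 := by
    rw [Finset.card_filter, Finset.sum_product_right]
    refine Finset.sum_le_sum fun t _ => ?_
    rw [← Finset.card_filter]
    exact hle t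
  have h2 : ((A ×ˢ A).filter (fun p => p.2 ∈ shadow (L p.1))).card ≤ ∑ t ∈ A, (L t).card ^ 2 := by
    rw [Finset.card_filter, Finset.sum_product]
    refine Finset.sum_le_sum fun t _ => ?_
    rw [← Finset.card_filter]
    exact hle t
  have := (Finset.card_le_card key).trans (Finset.card_union_le _ _)
  rw [Finset.card_product] at this
  nlinarith

/-- In a `k × k` grid, every customizable hub labeling has average label size at least
`(2 / 3) * √(2 / 3) * k`. -/
theorem sum_card_ge_of_isCuHL_gridGraph {k : ℕ} (hk : 0 < k)
    {L : Fin k × Fin k → Finset (Fin k × Fin k)} (hL : IsCuHL (gridGraph k) L) :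
    (2 / 3) * √(2 / 3) * k * (k * k : ℕ) ≤ ∑ v, ((L v).card : ℝ) := by
  classical
  -- With `g` labels below `θ * k`, the total is at least `g² / (2θk) + (k² - g)θk`, which is
  -- minimal at `g = θ²k²` with value `(θ - θ³/2)k³`. The choice `θ² = 2/3` maximizes this.
  set θ : ℝ := √(2 / 3) with hθ
  have hθ2 : θ ^ 2 = 2 / 3 := Real.sq_sqrt (by norm_num)
  have hθ0 : 0 < θ := Real.sqrt_pos.2 (by norm_num)
  have hθ1 : θ < 1 := by nlinarith
  have hk' : (0 : ℝ) < k := by exact_mod_cast hk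
  set A := Finset.univ.filter fun v => ((L v).card : ℝ) < θ * k with hA
  have hsq : ((A.card : ℝ)) ^ 2 ≤ 2 * ∑ t ∈ A, ((L t).card : ℝ) ^ 2 := by
    exact_mod_cast sq_card_le_two_mul_sum_sq hL A fun t ht => by
      have := (Finset.mem_filter.1 ht).2
      have : ((L t).card : ℝ) < k := by nlinarith
      exact_mod_cast this
  have hgood : ∑ t ∈ A, ((L t).card : ℝ) ^ 2 ≤ θ * k * ∑ t ∈ A, ((L t).card : ℝ) := by
    rw [Finset.mul_sum]
    refine Finset.sum_le_sum fun t ht => ?_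
    have := (Finset.mem_filter.1 ht).2
    rw [sq]
    exact mul_le_mul_of_nonneg_right this.le (Nat.cast_nonneg _)
  have hbad : (Aᶜ.card : ℝ) * (θ * k) ≤ ∑ t ∈ Aᶜ, ((L t).card : ℝ) := by
    rw [← nsmul_eq_mul]
    refine Finset.card_nsmul_le_sum _ _ _ fun t ht => ?_
    by_contra! h
    exact (Finset.mem_compl.1 ht) (Finset.mem_filter.2 ⟨Finset.mem_univ _, h⟩)
  have hcard : (A.card : ℝ) + Aᶜ.card = k * k := by
    have := A.card_add_card_compl
    rw [Fintype.card_prod, Fintype.card_fin] at this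
    exact_mod_cast this
  rw [← Finset.sum_add_sum_compl A]
  set g : ℝ := (A.card : ℝ)
  set b : ℝ := (Aᶜ.card : ℝ)
  set X : ℝ := ∑ t ∈ A, ((L t).card : ℝ)
  set Y : ℝ := ∑ t ∈ Aᶜ, ((L t).card : ℝ)
  have hb : b = k * k - g := by linarith
  rw [hb] at hbad
  have h3 : g ^ 2 ≤ 2 * (θ * k * X) := by linarith
  -- Cleared of the denominator `2θk`, the claim is that the square of `g - (2/3)k²` is nonnegative.
  have h4 : (2 / 3 * k * k * k * θ - (k * k - g) * (θ * k)) * (2 * (θ * k)) ≤ g ^ 2 := by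
    have : (2 / 3 * k * k * k * θ - (k * k - g) * (θ * k)) * (2 * (θ * k))
      = θ ^ 2 * (2 * k ^ 2 * g - 2 / 3 * k ^ 4) := by ring
    rw [this, hθ2]
    nlinarith [sq_nonneg (g - 2 / 3 * k ^ 2)]
  have h5 : 2 / 3 * k * k * k * θ - (k * k - g) * (θ * k) ≤ X := by
    have hpos : 0 < 2 * (θ * k) := by positivity
    refine le_of_mul_le_mul_right ?_ hpos
    linarith
  push_cast
  nlinarith

theorem IsCuHL.map_iso {V W : Type*} {G : SimpleGraph V} {H : SimpleGraph W}
    (φ : G ≃g H) {L : V → Finset V} (hL : IsCuHL G L) :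
    IsCuHL H fun w => (L (φ.symm w)).map φ.toEquiv.toEmbedding := by
  intro s t P hP
  obtain ⟨w, hw, hs, ht⟩ := hL _ _ (P.map φ.symm.toHom)
    (hP.map φ.symm.injective)
  rw [SimpleGraph.Walk.support_map, List.mem_map] at hw
  obtain ⟨v, hv, rfl⟩ := hw
  refine ⟨v, hv, ?_, ?_⟩ <;> rw [Finset.mem_map]
  · exact ⟨_, hs, φ.apply_symm_apply v⟩
  · exact ⟨_, ht, φ.apply_symm_apply v⟩

theorem avgLabelSize_ge_of_iso {V : Type*} [Fintype V] {G : SimpleGraph V} {k : ℕ} (hk : 0 < k)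
    (φ : G ≃g gridGraph k) {L : V → Finset V} (hL : IsCuHL G L) :
    (2 / 3) * √(2 / 3) * k ≤ avgLabelSize L := by
  have h := sum_card_ge_of_isCuHL_gridGraph hk (hL.map_iso φ)
  have hc : Fintype.card V = k * k := by
    rw [Fintype.card_congr φ.toEquiv, Fintype.card_prod, Fintype.card_fin]
  rw [avgLabelSize, hc, le_div_iff₀ (by exact_mod_cast Nat.mul_pos hk hk)]
  refine h.trans_eq ?_
  simp only [Finset.card_map]
  exact Equiv.sum_comp φ.symm.toEquiv fun v => ((L v).card : ℝ)

/-! ### The nested dissection labeling -/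

/-- Nested dissection of the rectangle `[a, b) × [c, d)`: the middle column `m` separates; inside
the separator the second coordinate decides, and the two sides are treated with the coordinates swapped.
The value is `1` iff `(xu, yu)` is a hub of `(xv, yv)`. The first argument bounds the depth. -/
def hub : ℕ → ℕ → ℕ → ℕ → ℕ → ℕ → ℕ → ℕ → ℕ → ℕ
  | 0, _, _, _, _, _, _, _, _ => 0
  | f + 1, a, b, c, d, xv, yv, xu, yu =>
    if xu = (a + b) / 2 then
      if xv = (a + b) / 2 then if yu < yv then 0 else 1
      else 1
    else if xv < (a + b) / 2 then
      if xu < (a + b) / 2 then hub f c d a ((a + b) / 2) yv xv yu xu else 0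
    else if xv = (a + b) / 2 then 0
    else if xu < (a + b) / 2 then 0
    else hub f c d ((a + b) / 2 + 1) b yv xv yu xu

/-- The rank of a vertex in the nested dissection order. -/
def hubKey (N : ℕ) : ℕ → ℕ → ℕ → ℕ → ℕ → ℕ → ℕ → ℕ
  | 0, _, _, _, _, _, _ => 0
  | f + 1, a, b, c, d, x, y =>
    if x = (a + b) / 2 then (f + 1) * N + y
    else if x < (a + b) / 2 then hubKey N f c d a ((a + b) / 2) y x
    else hubKey N f c d ((a + b) / 2 + 1) b y x

/-- Each level of the recursion owns a block of `N` keys, so everything below a separator ranks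
lower than the separator itself. -/
theorem hubKey_lt {N f a b c d x y : ℕ} (hx : x < N) (hy : y < N) :
    hubKey N f a b c d x y < (f + 1) * N := by
  induction f generalizing a b c d x y with
  | zero => simp only [hubKey]; omega
  | succ f ih =>
    have h : (f + 1 + 1) * N = (f + 1) * N + N := by ring
    unfold hubKey
    split_ifs
    · omega
    · have := @ih c d a ((a + b) / 2) y x hy hx
      omega
    · have := @ih c d ((a + b) / 2 + 1) b y x hy hx
      omega

theorem hubKey_lt_of_hub {N f a b c d xv yv xu yu : ℕ} (hx : xv < N) (hy : yv < N)
    (h : hub f a b c d xv yv xu yu ≠ 0) (hne : xv ≠ xu ∨ yv ≠ yu) :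
    hubKey N f a b c d xv yv < hubKey N f a b c d xu yu := by
  induction f generalizing a b c d xv yv xu yu with
  | zero => exact absurd rfl h
  | succ f ih =>
    have h1 := @hubKey_lt N f c d a ((a + b) / 2) yv xv hy hx
    have h2 := @hubKey_lt N f c d ((a + b) / 2 + 1) b yv xv hy hx
    unfold hub at h
    unfold hubKey
    split_ifs at h ⊢ <;> first | omega | exact ih hy hx h hne.symm

/-- Connectedness enters only through the discrete intermediate value property of both coordinates.
This is symmetric under the coordinate swap and keeps `W` fixed throughout the induction. Every
split discards at least the separator column, so the depth `f` cannot run out first. -/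
theorem exists_hub_of_connected {V : Type*} {x y : V → ℕ} {W : Finset V}
    {f a b c d : ℕ} {s t : V} (hs : s ∈ W) (ht : t ∈ W)
    (hx : ∀ m, (∀ w ∈ W, x w ≠ m) → (∀ w ∈ W, x w < m) ∨ ∀ w ∈ W, m < x w)
    (hy : ∀ m, (∀ w ∈ W, y w ≠ m) → (∀ w ∈ W, y w < m) ∨ ∀ w ∈ W, m < y w)
    (hW : ∀ w ∈ W, a ≤ x w ∧ x w < b ∧ c ≤ y w ∧ y w < d) (hf : b - a + (d - c) ≤ f) :
    ∃ w ∈ W, hub f a b c d (x s) (y s) (x w) (y w) ≠ 0 ∧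
      hub f a b c d (x t) (y t) (x w) (y w) ≠ 0 := by
  induction f generalizing x y a b c d with
  | zero =>
    have := hW s hs
    omega
  | succ f ih =>
    have hab := hW s hs
    by_cases hm : ∃ w ∈ W, x w = (a + b) / 2
    -- The separator vertex with the largest second coordinate is a hub of every vertex of `W`,
    -- including those on the separator.
    · obtain ⟨w, hw, hmax⟩ := Finset.exists_max_image (W.filter fun w => x w = (a + b) / 2) y
        (by obtain ⟨w, hw, h⟩ := hm; exact ⟨w, Finset.mem_filter.2 ⟨hw, h⟩⟩)
      have hw' := Finset.mem_filter.1 hw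
      have key : ∀ v ∈ W, hub (f + 1) a b c d (x v) (y v) (x w) (y w) ≠ 0 := by
        intro v hv
        unfold hub
        rw [if_pos hw'.2]
        split_ifs with h1 h2
        · have := hmax v (Finset.mem_filter.2 ⟨hv, h1⟩)
          omega
        · exact one_ne_zero
        · exact one_ne_zero
      exact ⟨w, hw'.1, key s hs, key t ht⟩
    · push Not at hm
      rcases hx _ hm with h | h
      · obtain ⟨w, hw, h1, h2⟩ := @ih y x c d a ((a + b) / 2) hy hx
          (fun w hw => ⟨(hW w hw).2.2.1, (hW w hw).2.2.2, (hW w hw).1, h w hw⟩) (by omega)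
        refine ⟨w, hw, ?_, ?_⟩ <;> unfold hub <;>
          rwa [if_neg (hm w hw), if_pos (h _ ‹_›), if_pos (h w hw)]
      · obtain ⟨w, hw, h1, h2⟩ := @ih y x c d ((a + b) / 2 + 1) b hy hx
          (fun w hw => ⟨(hW w hw).2.2.1, (hW w hw).2.2.2, h w hw, (hW w hw).2.1⟩) (by omega)
        refine ⟨w, hw, ?_, ?_⟩ <;> unfold hub <;>
          rwa [if_neg (hm w hw), if_neg (h _ ‹_›).not_gt, if_neg (hm _ ‹_›),
            if_neg (h w hw).not_gt]

/-- A separator costs at most the height `d - c`. The remaining side has width at most half of `b -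
a` and is treated with the roles of width and height exchanged. Thus the bound satisfies `(d - c) +
(2 * ((b - a) / 2) + (d - c)) ≤ 2 * (d - c) + (b - a)`. -/
theorem card_hub_le {V : Type*} {x y : V → ℕ} {U : Finset V}
    (hinj : ∀ u ∈ U, ∀ v ∈ U, x u = x v → y u = y v → u = v) {f a b c d xv yv : ℕ}
    (hxv : a ≤ xv ∧ xv < b)
    (hU : ∀ u ∈ U, a ≤ x u ∧ x u < b ∧ c ≤ y u ∧ y u < d)
    (hyv : c ≤ yv ∧ yv < d) :
    (U.filter fun u => hub f a b c d xv yv (x u) (y u) ≠ 0).card ≤ 2 * (d - c) + (b - a) := by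
  classical
  induction f generalizing x y a b c d xv yv U with
  | zero => simp [hub]
  | succ f ih =>
    have hcol : (U.filter fun u => x u = (a + b) / 2).card ≤ d - c := by
      rw [← Nat.card_Ico]
      refine Finset.card_le_card_of_injOn y ?_ ?_
      · intro u hu
        have := hU u (Finset.mem_filter.1 hu).1
        simpa using this.2.2
      · intro u hu v hv h
        have hu := Finset.mem_filter.1 hu
        have hv := Finset.mem_filter.1 hv
        exact hinj u hu.1 v hv.1 (hu.2.trans hv.2.symm) h
    rcases lt_trichotomy xv ((a + b) / 2) with h | h | h
    · have hsub : (U.filter fun u => hub (f + 1) a b c d xv yv (x u) (y u) ≠ 0) ⊆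
          (U.filter fun u => x u = (a + b) / 2) ∪
          ((U.filter fun u => x u < (a + b) / 2).filter fun u =>
            hub f c d a ((a + b) / 2) yv xv (y u) (x u) ≠ 0) := by
        intro u hu
        rw [Finset.mem_filter] at hu
        obtain ⟨hu, h'⟩ := hu
        simp only [Finset.mem_union, Finset.mem_filter]
        unfold hub at h'
        split_ifs at h' with h1 h2 h3 h4 <;>
          first | exact Or.inl ⟨hu, h1⟩ | exact Or.inr ⟨⟨hu, h4⟩, h'⟩ | omega
      have := ih (x := y) (y := x) (U := U.filter fun u => x u < (a + b) / 2) (a := c) (b := d)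
        (c := a) (d := (a + b) / 2) (xv := yv) (yv := xv)
        (fun u hu v hv h1 h2 =>
          hinj u (Finset.mem_filter.1 hu).1 v (Finset.mem_filter.1 hv).1 h2 h1) hyv
        (fun u hu => by
          have hu := Finset.mem_filter.1 hu
          have := hU u hu.1
          exact ⟨this.2.2.1, this.2.2.2, this.1, hu.2⟩) ⟨hxv.1, h⟩
      have := (Finset.card_le_card hsub).trans (Finset.card_union_le _ _)
      omega
    · have hsub : (U.filter fun u => hub (f + 1) a b c d xv yv (x u) (y u) ≠ 0) ⊆
          (U.filter fun u => x u = (a + b) / 2) := by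
        intro u hu
        rw [Finset.mem_filter] at hu ⊢
        obtain ⟨hu, h'⟩ := hu
        unfold hub at h'
        split_ifs at h' with h1 h2 h3 h4 <;> first | exact ⟨hu, h1⟩ | omega
      have := Finset.card_le_card hsub
      omega
    · have hsub : (U.filter fun u => hub (f + 1) a b c d xv yv (x u) (y u) ≠ 0) ⊆
          (U.filter fun u => x u = (a + b) / 2) ∪
          ((U.filter fun u => (a + b) / 2 < x u).filter fun u =>
            hub f c d ((a + b) / 2 + 1) b yv xv (y u) (x u) ≠ 0) := by
        intro u hu
        rw [Finset.mem_filter] at hu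
        obtain ⟨hu, h'⟩ := hu
        simp only [Finset.mem_union, Finset.mem_filter]
        unfold hub at h'
        split_ifs at h' with h1 h2 h3 h4 h5 <;>
          first | exact Or.inl ⟨hu, h1⟩ | exact Or.inr ⟨⟨hu, by omega⟩, h'⟩ | omega
      have := ih (x := y) (y := x) (U := U.filter fun u => (a + b) / 2 < x u) (a := c) (b := d)
        (c := (a + b) / 2 + 1) (d := b) (xv := yv) (yv := xv)
        (fun u hu v hv h1 h2 =>
          hinj u (Finset.mem_filter.1 hu).1 v (Finset.mem_filter.1 hv).1 h2 h1) hyv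
        (fun u hu => by
          have hu := Finset.mem_filter.1 hu
          have := hU u hu.1
          exact ⟨this.2.2.1, this.2.2.2, hu.2, this.2.1⟩) ⟨h, hxv.2⟩
      have := (Finset.card_le_card hsub).trans (Finset.card_union_le _ _)
      omega

theorem forall_lt_or_forall_gt_of_walk {V : Type*} {G : SimpleGraph V} {x : V → ℕ}
    (hx : ∀ u v, G.Adj u v → x u ≤ x v + 1) {s t : V} (P : G.Walk s t) (m : ℕ)
    (h : ∀ w ∈ P.support, x w ≠ m) :
    (∀ w ∈ P.support, x w < m) ∨ ∀ w ∈ P.support, m < x w := by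
  induction P with
  | nil =>
    simp only [SimpleGraph.Walk.support_nil, List.mem_singleton, forall_eq] at h ⊢
    omega
  | @cons u v w huv p ih =>
    simp only [SimpleGraph.Walk.support_cons, List.mem_cons, forall_eq_or_imp] at h ⊢
    have h1 := hx u v huv
    have h2 := hx v u huv.symm
    rcases ih h.2 with h3 | h3
    · have := h3 v p.start_mem_support
      exact Or.inl ⟨by omega, h3⟩
    · have := h3 v p.start_mem_support
      exact Or.inr ⟨by omega, h3⟩

/-- Sorting by key breaks ties arbitrarily. This is harmless because distinct vertices related by a
label have distinct keys. -/
theorem exists_equiv_of_key {n : ℕ} {L : Fin n → Finset (Fin n)} (key : Fin n → ℕ)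
    (h : ∀ u v, u ∈ L v → v ≠ u → key v < key u) :
    ∃ π : Fin n ≃ Fin (Fintype.card (Fin n)), Respects L π := by
  refine ⟨(Tuple.sort key).symm.trans (finCongr (Fintype.card_fin n).symm), fun u v huv => ?_⟩
  by_contra! hlt
  have hlt' : (Tuple.sort key).symm u < (Tuple.sort key).symm v := hlt
  have hmono := Tuple.monotone_sort key hlt'.le
  simp only [Function.comp_apply, Equiv.apply_symm_apply] at hmono
  rcases eq_or_ne v u with rfl | hne
  · exact lt_irrefl _ hlt
  · exact absurd (h u v huv hne) (by omega)

/-- The labeling given by nested dissection with respect to coordinates `x`, `y`. -/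
def hubLabeling {n : ℕ} (k : ℕ) (x y : Fin n → ℕ) (v : Fin n) : Finset (Fin n) :=
  Finset.univ.filter fun u => hub (k + k) 0 k 0 k (x v) (y v) (x u) (y u) ≠ 0

section

variable {n k : ℕ} {G : SimpleGraph (Fin n)} {x y : Fin n → ℕ}

theorem isHCuHL_hubLabeling (hxk : ∀ v, x v < k) (hyk : ∀ v, y v < k)
    (hinj : ∀ u v, x u = x v → y u = y v → u = v)
    (hx : ∀ u v, G.Adj u v → x u ≤ x v + 1) (hy : ∀ u v, G.Adj u v → y u ≤ y v + 1) :
    IsHCuHL G (hubLabeling k x y) := by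
  classical
  refine ⟨fun s t P _ => ?_, ?_⟩
  · obtain ⟨w, hw, h1, h2⟩ := exists_hub_of_connected (x := x) (y := y) (W := P.support.toFinset)
      (f := k + k) (a := 0) (b := k) (c := 0) (d := k) (s := s) (t := t) (by simp) (by simp)
      (fun m => by simpa using forall_lt_or_forall_gt_of_walk hx P m)
      (fun m => by simpa using forall_lt_or_forall_gt_of_walk hy P m)
      (fun w _ => ⟨Nat.zero_le _, hxk w, Nat.zero_le _, hyk w⟩) (by omega)
    exact ⟨w, by simpa using hw, by simpa [hubLabeling] using h1, by simpa [hubLabeling] using h2⟩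
  · refine exists_equiv_of_key (fun v => hubKey k (k + k) 0 k 0 k (x v) (y v)) ?_
    intro u v huv hne
    refine hubKey_lt_of_hub (hxk v) (hyk v) (Finset.mem_filter.1 huv).2 ?_
    by_contra! hc
    exact hne (hinj v u hc.1 hc.2)

theorem avgLabelSize_hubLabeling_le (hxk : ∀ v, x v < k) (hyk : ∀ v, y v < k)
    (hinj : ∀ u v, x u = x v → y u = y v → u = v) :
    avgLabelSize (hubLabeling k x y) ≤ 3 * k := by
  have h (v : Fin n) : ((hubLabeling k x y v).card : ℝ) ≤ 3 * k := by
    have : (hubLabeling k x y v).card ≤ 2 * (k - 0) + (k - 0) :=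
      card_hub_le (fun u _ v _ => hinj u v) ⟨Nat.zero_le _, hxk v⟩
        (fun u _ => ⟨Nat.zero_le _, hxk u, Nat.zero_le _, hyk u⟩) ⟨Nat.zero_le _, hyk v⟩
    have : (hubLabeling k x y v).card ≤ 3 * k := by omega
    exact_mod_cast this
  refine div_le_of_le_mul₀ (Nat.cast_nonneg _) (by positivity) ?_
  refine (Finset.sum_le_card_nsmul _ _ _ fun v _ => h v).trans_eq ?_
  rw [nsmul_eq_mul, Finset.card_univ, mul_comm]

end

/-! ### Reasoning about programs with time bounds -/

/-- Started in `σ`, the program `p` halts after at most `T` steps in a store with property `Q`. -/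
def Ends (p : Prog) (σ : Store) (T : ℕ) (Q : Store → Prop) : Prop :=
  ∃ t τ, Run p σ t τ ∧ t ≤ T ∧ Q τ

theorem Ends.mono {p : Prog} {σ : Store} {T T' : ℕ} {Q Q' : Store → Prop}
    (h : Ends p σ T Q) (hT : T ≤ T') (hQ : ∀ τ, Q τ → Q' τ) : Ends p σ T' Q' := by
  obtain ⟨t, τ, h1, h2, h3⟩ := h
  exact ⟨t, τ, h1, h2.trans hT, hQ τ h3⟩

theorem Ends.skip {σ : Store} {T : ℕ} {Q : Store → Prop} (h : Q σ) (hT : 1 ≤ T) :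
    Ends .skip σ T Q :=
  ⟨_, _, .skip σ, hT, h⟩

theorem Ends.assign {σ : Store} {x : ℕ} {e : Expr} {T : ℕ} {Q : Store → Prop}
    (h : Q (σ.setVar x (e.eval σ))) (hT : e.cost + 1 ≤ T) : Ends (.assign x e) σ T Q :=
  ⟨_, _, .assign σ x e, hT, h⟩

theorem Ends.store {σ : Store} {a : ℕ} {i j e : Expr} {T : ℕ} {Q : Store → Prop}
    (h : Q (σ.setArr a (i.eval σ) (j.eval σ) (e.eval σ)))
    (hT : i.cost + j.cost + e.cost + 1 ≤ T) : Ends (.store a i j e) σ T Q :=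
  ⟨_, _, .store σ a i j e, hT, h⟩

theorem Ends.seq {p q : Prog} {σ : Store} {T₁ T₂ : ℕ} {Q : Store → Prop}
    (h : Ends p σ T₁ fun τ => Ends q τ T₂ Q) : Ends (.seq p q) σ (T₁ + T₂) Q := by
  obtain ⟨t, τ, h1, h2, t', τ', h3, h4, h5⟩ := h
  exact ⟨_, _, .seq h1 h3, Nat.add_le_add h2 h4, h5⟩

theorem Ends.ite {p q : Prog} {e : Expr} {σ : Store} {T : ℕ} {Q : Store → Prop}
    (h1 : e.eval σ ≠ 0 → Ends p σ T Q) (h2 : e.eval σ = 0 → Ends q σ T Q) :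
    Ends (.ite e p q) σ (e.cost + 1 + T) Q := by
  by_cases h : e.eval σ = 0
  · obtain ⟨t, τ, h3, h4, h5⟩ := h2 h
    exact ⟨_, _, .iteFalse h h3, Nat.add_le_add_left h4 _, h5⟩
  · obtain ⟨t, τ, h3, h4, h5⟩ := h1 h
    exact ⟨_, _, .iteTrue h h3, Nat.add_le_add_left h4 _, h5⟩

/-- The index of the invariant is a variant that bounds the remaining iterations. It may drop by
more than one, which allows early exits. -/
theorem Ends.loop {p : Prog} {e : Expr} {T : ℕ} (Inv : ℕ → Store → Prop)
    (hstep : ∀ f σ, Inv f σ → e.eval σ ≠ 0 → Ends p σ T fun τ => ∃ g < f, Inv g τ)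
    {f : ℕ} {σ : Store} (h : Inv f σ) :
    Ends (.loop e p) σ ((f + 1) * (e.cost + 1 + T)) fun τ => e.eval τ = 0 ∧ ∃ g, Inv g τ := by
  induction f using Nat.strong_induction_on generalizing σ with
  | _ f ih =>
    by_cases he : e.eval σ = 0
    · refine ⟨_, _, .loopDone he, ?_, he, f, h⟩
      nlinarith [Nat.zero_le (f * (e.cost + 1 + T))]
    · obtain ⟨t, τ, h1, h2, g, hg, h3⟩ := hstep f σ h he
      obtain ⟨t', τ', h4, h5, h6⟩ := ih g hg h3
      refine ⟨_, _, .loopStep he h1 h4, ?_, h6⟩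
      have : (g + 1) * (e.cost + 1 + T) ≤ f * (e.cost + 1 + T) := Nat.mul_le_mul_right _ hg
      have : (f + 1) * (e.cost + 1 + T) = f * (e.cost + 1 + T) + (e.cost + 1 + T) := by ring
      omega

/-- Run `p` with the variable `x` going through all numbers below the value of the variable `0`. -/
def forAll (x : ℕ) (p : Prog) : Prog :=
  .seq (.assign x (.const 0))
    (.loop (.lt (.var x) (.var 0)) (.seq p (.assign x (.add (.var x) (.const 1)))))

/-- The loop test and the increment cost four steps each, and the initialization two. -/
theorem Ends.forAll {x n T : ℕ} {p : Prog} {σ : Store} (Inv : ℕ → Store → Prop)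
    (hn : ∀ i τ, Inv i τ → τ.var 0 = n) (h0 : Inv 0 (σ.setVar x 0))
    (hstep : ∀ i τ, i < n → Inv i τ → τ.var x = i →
      Ends p τ T fun ρ => ρ.var x = i ∧ Inv (i + 1) (ρ.setVar x (i + 1))) :
    Ends (forAll x p) σ ((n + 1) * (T + 8) + 2) (Inv n) := by
  have h := Ends.loop (p := .seq p (.assign x (.add (.var x) (.const 1))))
    (e := .lt (.var x) (.var 0)) (T := T + 4)
    (fun f τ => ∃ i, i + f = n ∧ τ.var x = i ∧ Inv i τ) (f := n) (σ := σ.setVar x 0)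
    (by
      rintro f τ ⟨i, hi, hx, hI⟩ he
      have hlt : i < n := by
        by_contra hc
        simp [Expr.eval, hx, hn i τ hI, hc] at he
      refine Ends.seq ((hstep i τ hlt hI hx).mono le_rfl ?_)
      rintro ρ ⟨hρ, hI'⟩
      refine Ends.assign ⟨f - 1, by omega, i + 1, by omega, ?_, ?_⟩ (by simp [Expr.cost])
      · simp [Store.setVar, Expr.eval, hρ]
      · simpa [Expr.eval, hρ] using hI')
    ⟨0, by omega, by simp [Store.setVar], h0⟩
  refine (Ends.seq (T₁ := 2) (T₂ := (n + 1) * (T + 8)) (Ends.assign ?_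
    (by simp [Expr.cost]))).mono (by omega) (fun _ h => h)
  refine h.mono (Nat.mul_le_mul_left _ (by simp only [Expr.cost]; omega)) ?_
  rintro τ ⟨he, f, i, hi, hx, hI⟩
  have hlt : ¬ i < n := by
    intro hc
    simp [Expr.eval, hx, hn i τ hI, hc] at he
  obtain rfl : i = n := by omega
  exact hI

/-! ### Side length and grid metric -/

/-- Variable `1` gets the side length of the grid. -/
def sideProg : Prog :=
  .loop (.lt (.var 2) (.var 0))
    (.seq (.assign 2 (.add (.add (.var 2) (.add (.var 1) (.var 1))) (.const 1)))
      (.assign 1 (.add (.var 1) (.const 1))))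

/-- Variable `2` holds the square of variable `1`, updated by `(i + 1)² = i² + 2i + 1` since the
machine cannot multiply. -/
theorem sideProg_ends {k : ℕ} {σ : Store} (h0 : σ.var 0 = k * k) (h1 : σ.var 1 = 0)
    (h2 : σ.var 2 = 0) :
    Ends sideProg σ ((k + 1) * 16) fun τ => τ.var 0 = k * k ∧ τ.var 1 = k ∧ τ.arr = σ.arr := by
  have h := Ends.loop (T := 12)
    (p := .seq (.assign 2 (.add (.add (.var 2) (.add (.var 1) (.var 1))) (.const 1)))
      (.assign 1 (.add (.var 1) (.const 1))))
    (e := .lt (.var 2) (.var 0))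
    (fun f τ => ∃ i, i + f = k ∧ τ.var 1 = i ∧ τ.var 2 = i * i ∧ τ.var 0 = k * k ∧ τ.arr = σ.arr)
    (f := k) (σ := σ)
    (by
      rintro f τ ⟨i, hi, h1, h2, h0, ha⟩ he
      have hlt : i * i < k * k := by
        by_contra hc
        simp [Expr.eval, h2, h0, hc] at he
      have hlt' : i < k := by
        by_contra hc
        exact absurd (Nat.mul_le_mul (not_lt.1 hc) (not_lt.1 hc)) (by omega)
      refine Ends.seq (T₁ := 8) (T₂ := 4) (Ends.assign (Ends.assign ?_ ?_) ?_)
      · refine ⟨f - 1, by omega, i + 1, by omega, ?_⟩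
        simp [Store.setVar, Expr.eval, h0, h1, h2, ha]
        ring
      · simp [Expr.cost]
      · simp [Expr.cost])
    ⟨0, by simp [h0, h1, h2]⟩
  refine h.mono (by simp [Expr.cost]) ?_
  rintro τ ⟨he, f, i, hi, h1, h2, h0, ha⟩
  refine ⟨h0, ?_, ha⟩
  have hle : ¬ i * i < k * k := by
    intro hc
    simp [Expr.eval, h2, h0, hc] at he
  have : ¬ i < k := fun hc => hle (Nat.mul_self_lt_mul_self hc)
  omega

/-- The distance of the points with numbers `i` and `j` in a grid. -/
def gridDist (x y : ℕ → ℕ) (i j : ℕ) : ℕ :=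
  (x i - x j) + (x j - x i) + ((y i - y j) + (y j - y i))

/-- `A` is the adjacency matrix of a `k × k` grid with `n` vertices, which have the coordinates
`x`, `y`. -/
structure GridMatrix (n k : ℕ) (A : ℕ → ℕ → ℕ) (x y : ℕ → ℕ) : Prop where
  card_eq : n = k * k
  pos : 0 < k
  x_lt : ∀ i < n, x i < k
  y_lt : ∀ i < n, y i < k
  inj : ∀ i < n, ∀ j < n, x i = x j → y i = y j → i = j
  surj : ∀ a < k, ∀ b < k, ∃ i < n, x i = a ∧ y i = b
  adj : ∀ i < n, ∀ j < n, A i j ≠ 0 ↔ gridDist x y i j = 1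

section

variable {n k : ℕ} {A : ℕ → ℕ → ℕ} {x y : ℕ → ℕ}

/-- This ensures that `n` rounds of breadth-first search reach every vertex. -/
theorem GridMatrix.dist_le (h : GridMatrix n k A x y) {i j : ℕ} (hi : i < n) (hj : j < n) :
    gridDist x y i j ≤ n := by
  have h1 := h.x_lt i hi
  have h2 := h.x_lt j hj
  have h3 := h.y_lt i hi
  have h4 := h.y_lt j hj
  have h5 := h.card_eq
  have : 2 * k ≤ k * k + 1 := by
    have := h.pos
    rcases Nat.lt_or_ge k 2 with h | h
    · interval_cases k; simp
    · nlinarith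
  unfold gridDist
  omega

/-- Move one step from `v` towards `s` in a coordinate where they differ. -/
theorem GridMatrix.dist_pred (h : GridMatrix n k A x y) {s v r : ℕ} (hs : s < n) (hv : v < n)
    (hd : gridDist x y s v = r + 1) : ∃ u < n, A u v ≠ 0 ∧ gridDist x y s u = r := by
  have h1 := h.x_lt s hs
  have h2 := h.x_lt v hv
  have h3 := h.y_lt s hs
  have h4 := h.y_lt v hv
  unfold gridDist at hd
  have key : ∃ a < k, ∃ b < k, (a - x v) + (x v - a) + ((b - y v) + (y v - b)) = 1 ∧
      (x s - a) + (a - x s) + ((y s - b) + (b - y s)) = r := by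
    rcases lt_trichotomy (x s) (x v) with hx | hx | hx
    · exact ⟨x v - 1, by omega, y v, h4, by omega, by omega⟩
    · rcases lt_trichotomy (y s) (y v) with hy | hy | hy
      · exact ⟨x v, h2, y v - 1, by omega, by omega, by omega⟩
      · omega
      · exact ⟨x v, h2, y v + 1, by omega, by omega, by omega⟩
    · exact ⟨x v + 1, by omega, y v, h4, by omega, by omega⟩
  obtain ⟨a, ha, b, hb, e1, e2⟩ := key
  obtain ⟨u, hu, rfl, rfl⟩ := h.surj a ha b hb
  exact ⟨u, hu, (h.adj u hu v hv).2 e1, e2⟩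

theorem gridDist_le_add (s u v : ℕ) :
    gridDist x y s v ≤ gridDist x y s u + gridDist x y u v := by
  unfold gridDist
  omega

theorem GridMatrix.dist_eq_zero (h : GridMatrix n k A x y) {i j : ℕ} (hi : i < n) (hj : j < n) :
    gridDist x y i j = 0 ↔ i = j := by
  constructor
  · intro hd
    unfold gridDist at hd
    exact h.inj i hi j hj (by omega) (by omega)
  · rintro rfl
    unfold gridDist
    omega

end

/-! ### All distances by breadth-first search -/

/-- The step of the breadth-first search from vertex `3` for the edge between `5` and `6`. -/
def markProg : Prog :=
  .ite (.get 0 (.var 5) (.var 6))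
    (.ite (.eq (.get 2 (.var 3) (.var 5)) (.add (.var 4) (.const 1)))
      (.ite (.get 2 (.var 3) (.var 6)) .skip
        (.store 2 (.var 3) (.var 6) (.add (.var 4) (.const 2))))
      .skip)
    .skip

/-- Array `2` gets the distances plus one, by a breadth-first search from each vertex. -/
def distProg : Prog :=
  forAll 3 (.seq (.store 2 (.var 3) (.var 3) (.const 1))
    (forAll 4 (forAll 5 (forAll 6 markProg))))

section

variable {n k : ℕ} {A : ℕ → ℕ → ℕ} {x y : ℕ → ℕ}

/-- The variables `0`, `1` and the array `0` have their values. -/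
def Base (n k : ℕ) (A : ℕ → ℕ → ℕ) (σ : Store) : Prop :=
  σ.var 0 = n ∧ σ.var 1 = k ∧ σ.arr 0 = A

/-- The state of the search from `s`, when all vertices within distance `r` are marked and
the rows before `s` are finished. -/
structure Search (n k : ℕ) (A : ℕ → ℕ → ℕ) (x y : ℕ → ℕ) (s r : ℕ) (σ : Store) : Prop where
  base : Base n k A σ
  var_s : σ.var 3 = s
  before : ∀ i < s, ∀ v < n, σ.arr 2 i v = gridDist x y i v + 1
  after : ∀ i, s < i → ∀ v, σ.arr 2 i v = 0
  sound : ∀ v < n, σ.arr 2 s v = 0 ∨ σ.arr 2 s v = gridDist x y s v + 1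
  marked : ∀ v < n, gridDist x y s v ≤ r → σ.arr 2 s v ≠ 0

theorem Search.setVar {s r z m : ℕ} {σ : Store} (h : Search n k A x y s r σ) (hz : 3 < z) :
    Search n k A x y s r (σ.setVar z m) := by
  obtain ⟨⟨b1, b2, b3⟩, h1, h2, h3, h4, h5⟩ := h
  refine ⟨⟨?_, ?_, b3⟩, ?_, h2, h3, h4, h5⟩
  · simpa [Store.setVar, show (0 : ℕ) ≠ z by omega] using b1
  · simpa [Store.setVar, show (1 : ℕ) ≠ z by omega] using b2
  · simpa [Store.setVar, show (3 : ℕ) ≠ z by omega] using h1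

/-- An unmarked `v` has distance more than `r`, while a neighbor at distance `r` gives at most `r +
1`; so the stored value is exact. Marks set in this round equal `r + 2` and fail the test for `r +
1`, so no queue is needed. -/
theorem markProg_ends (hG : GridMatrix n k A x y) {s r u v : ℕ} (hu : u < n)
    (hv : v < n) {σ : Store} (h : Search n k A x y s r σ) (h4 : σ.var 4 = r) (h5 : σ.var 5 = u)
    (h6 : σ.var 6 = v) :
    Ends markProg σ 40 fun τ => Search n k A x y s r τ ∧ τ.var = σ.var ∧
      (A u v ≠ 0 → gridDist x y s u = r → τ.arr 2 s v ≠ 0) ∧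
      ∀ w, σ.arr 2 s w ≠ 0 → τ.arr 2 s w ≠ 0 := by
  have hb := h.base
  have e0 : (Expr.get 0 (.var 5) (.var 6)).eval σ = A u v := by
    simp [Expr.eval, hb.2.2, h5, h6]
  have e1 : (Expr.eq (.get 2 (.var 3) (.var 5)) (.add (.var 4) (.const 1))).eval σ =
      if σ.arr 2 s u = r + 1 then 1 else 0 := by
    simp [Expr.eval, h.var_s, h5, h4]
  have e2 : (Expr.get 2 (.var 3) (.var 6)).eval σ = σ.arr 2 s v := by
    simp [Expr.eval, h.var_s, h6]
  refine Ends.mono (Ends.ite (T := 33) (fun hA => ?_) fun hA => ?_)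
    (by simp [Expr.cost]) fun _ h => h
  · rw [e0] at hA
    refine Ends.mono (Ends.ite (T := 20) (fun hd => ?_) fun hd => ?_)
      (by simp [Expr.cost]) fun _ h => h
    · rw [e1] at hd
      have hd' : σ.arr 2 s u = r + 1 := by
        by_contra hc
        simp [hc] at hd
      have hdu : gridDist x y s u = r := by
        rcases h.sound u hu with h' | h' <;> omega
      refine Ends.mono (Ends.ite (T := 10) (fun hm => ?_) fun hm => ?_)
        (by simp [Expr.cost]) fun _ h => h
      · rw [e2] at hm
        exact Ends.skip ⟨h, rfl, fun _ _ => hm, fun _ h => h⟩ (by omega)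
      · rw [e2] at hm
        have hdv : gridDist x y s v = r + 1 := by
          have h1 := gridDist_le_add (x := x) (y := y) s u v
          have h2 := (hG.adj u hu v hv).1 hA
          have h3 : ¬ gridDist x y s v ≤ r := fun hc => h.marked v hv hc hm
          omega
        refine Ends.store ?_ (by simp [Expr.cost])
        have hval : ∀ i w, (σ.setArr 2 s v (r + 2)).arr 2 i w =
            if i = s ∧ w = v then r + 2 else σ.arr 2 i w := by
          intro i w
          simp [Store.setArr]
        simp only [Expr.eval, h.var_s, h6, h4]
        refine ⟨⟨⟨hb.1, hb.2.1, ?_⟩, h.var_s, ?_, ?_, ?_, ?_⟩, rfl, ?_, ?_⟩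
        · rw [← hb.2.2]
          simp [Store.setArr]
        · intro i hi w hw
          rw [hval, if_neg (by omega), h.before i hi w hw]
        · intro i hi w
          rw [hval, if_neg (by omega), h.after i hi w]
        · intro w hw
          rw [hval]
          split_ifs with hc
          · obtain ⟨-, rfl⟩ := hc
            omega
          · exact h.sound w hw
        · intro w hw hd
          rw [hval]
          split_ifs with hc
          · omega
          · exact h.marked w hw hd
        · intro _ _
          rw [hval, if_pos ⟨rfl, rfl⟩]
          omega
        · intro w hw
          rw [hval]
          split_ifs with hc
          · omega
          · exact hw
    · rw [e1] at hd
      refine Ends.skip ⟨h, rfl, fun _ hdu => ?_, fun _ h => h⟩ (by omega)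
      exfalso
      have := h.marked u hu hdu.le
      rcases h.sound u hu with h' | h'
      · exact this h'
      · rw [hdu] at h'
        simp [h'] at hd
  · rw [e0] at hA
    exact Ends.skip ⟨h, rfl, fun h' => absurd hA h', fun _ h => h⟩ (by omega)

theorem markRow_ends (hG : GridMatrix n k A x y) {s r u : ℕ} (hu : u < n)
    {σ : Store} (h : Search n k A x y s r σ) (h4 : σ.var 4 = r) (h5 : σ.var 5 = u) :
    Ends (forAll 6 markProg) σ ((n + 1) * 48 + 2) fun τ => Search n k A x y s r τ ∧
      τ.var 4 = r ∧ τ.var 5 = u ∧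
      (∀ v < n, A u v ≠ 0 → gridDist x y s u = r → τ.arr 2 s v ≠ 0) ∧
      ∀ w, σ.arr 2 s w ≠ 0 → τ.arr 2 s w ≠ 0 := by
  refine Ends.forAll (T := 40) (fun q τ => Search n k A x y s r τ ∧ τ.var 4 = r ∧ τ.var 5 = u ∧
      (∀ v < q, A u v ≠ 0 → gridDist x y s u = r → τ.arr 2 s v ≠ 0) ∧
      ∀ w, σ.arr 2 s w ≠ 0 → τ.arr 2 s w ≠ 0) (fun _ _ h => h.1.base.1) ?_ ?_
  · exact ⟨h.setVar (by omega), by simpa [Store.setVar] using h4,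
      by simpa [Store.setVar] using h5, fun v hv => absurd hv (by omega), fun _ h => h⟩
  · rintro q τ hq ⟨hS, h4, h5, h7, h8⟩ h6
    refine (markProg_ends hG hu hq hS h4 h5 h6).mono le_rfl ?_
    rintro ρ ⟨hS', hvar, h9, h10⟩
    refine ⟨by rw [hvar, h6], hS'.setVar (by omega), by simpa [Store.setVar, hvar] using h4,
      by simpa [Store.setVar, hvar] using h5, fun v hv hA hd => ?_, fun w hw => h10 w (h8 w hw)⟩
    rcases Nat.lt_succ_iff_lt_or_eq.1 hv with hv | rfl
    · exact h10 v (h7 v hv hA hd)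
    · exact h9 hA hd

theorem markRound_ends (hG : GridMatrix n k A x y) {s r : ℕ} (hs : s < n)
    {σ : Store} (h : Search n k A x y s r σ) (h4 : σ.var 4 = r) :
    Ends (forAll 5 (forAll 6 markProg)) σ ((n + 1) * ((n + 1) * 48 + 10) + 2) fun τ =>
      Search n k A x y s (r + 1) τ ∧ τ.var 4 = r := by
  refine Ends.mono (Ends.forAll (T := (n + 1) * 48 + 2)
    (fun p τ => Search n k A x y s r τ ∧ τ.var 4 = r ∧
      ∀ u < p, ∀ v < n, A u v ≠ 0 → gridDist x y s u = r → τ.arr 2 s v ≠ 0)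
    (fun _ _ h => h.1.base.1) ?_ ?_) le_rfl ?_
  · exact ⟨h.setVar (by omega), by simpa [Store.setVar] using h4,
      fun v hv => absurd hv (by omega)⟩
  · rintro p τ hp ⟨hS, h4, h7⟩ h5
    refine (markRow_ends hG hp hS h4 h5).mono le_rfl ?_
    rintro ρ ⟨hS', h4', h5', h9, h10⟩
    refine ⟨h5', hS'.setVar (by omega), by simpa [Store.setVar] using h4',
      fun u hu v hv hA hd => ?_⟩
    rcases Nat.lt_succ_iff_lt_or_eq.1 hu with hu | rfl
    · exact h10 v (h7 u hu v hv hA hd)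
    · exact h9 v hv hA hd
  · rintro τ ⟨hS, h4, h7⟩
    refine ⟨⟨hS.base, hS.var_s, hS.before, hS.after, hS.sound, fun v hv hd => ?_⟩, h4⟩
    rcases Nat.le_succ_iff.1 hd with hd | hd
    · exact hS.marked v hv hd
    · obtain ⟨u, hu, hA, hd'⟩ := hG.dist_pred hs hv hd
      exact h7 u hu v hv hA hd'

theorem distProg_ends (hG : GridMatrix n k A x y) {σ : Store} (hb : Base n k A σ)
    (h2 : ∀ i v, σ.arr 2 i v = 0) :
    Ends distProg σ ((n + 1) * (4 + ((n + 1) * ((n + 1) * ((n + 1) * 48 + 10) + 10) + 2) + 8) + 2)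
      fun τ => Base n k A τ ∧ ∀ i < n, ∀ v < n, τ.arr 2 i v = gridDist x y i v + 1 := by
  refine Ends.mono (Ends.forAll (n := n)
    (T := 4 + ((n + 1) * ((n + 1) * ((n + 1) * 48 + 10) + 10) + 2))
    (fun s τ => Base n k A τ ∧ (∀ i < s, ∀ v < n, τ.arr 2 i v = gridDist x y i v + 1) ∧
      ∀ i, s ≤ i → ∀ v, τ.arr 2 i v = 0) (fun _ _ h => h.1.1) ?_ ?_) le_rfl
    (fun τ h => ⟨h.1, h.2.1⟩)
  · exact ⟨⟨by simpa [Store.setVar] using hb.1, by simpa [Store.setVar] using hb.2.1, hb.2.2⟩,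
      fun i hi => absurd hi (by omega), fun i _ => h2 i⟩
  · rintro s τ hs ⟨hb, hlt, hge⟩ h3
    refine Ends.seq (Ends.store ?_ (by simp [Expr.cost]))
    simp only [Expr.eval, h3]
    have hval : ∀ i w, (τ.setArr 2 s s 1).arr 2 i w =
        if i = s ∧ w = s then 1 else τ.arr 2 i w := by
      intro i w
      simp [Store.setArr]
    have hS : Search n k A x y s 0 (τ.setArr 2 s s 1) := by
      refine ⟨⟨hb.1, hb.2.1, ?_⟩, h3, ?_, ?_, ?_, ?_⟩
      · rw [← hb.2.2]
        simp [Store.setArr]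
      · intro i hi w hw
        rw [hval, if_neg (by omega), hlt i hi w hw]
      · intro i hi w
        rw [hval, if_neg (by omega), hge i hi.le w]
      · intro w hw
        rw [hval]
        split_ifs with hc
        · obtain ⟨-, rfl⟩ := hc
          rw [(hG.dist_eq_zero hs hs).2 rfl]
          omega
        · exact Or.inl (hge s le_rfl w)
      · intro w hw hd
        rw [hval, if_pos ⟨rfl, ((hG.dist_eq_zero hs hw).1 (by omega)).symm⟩]
        omega
    refine Ends.mono (Ends.forAll (n := n) (T := (n + 1) * ((n + 1) * 48 + 10) + 2)
      (fun r τ => Search n k A x y s r τ) (fun _ _ h => h.base.1) (hS.setVar (by omega)) ?_)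
      le_rfl ?_
    · intro r τ _ hS h4
      refine (markRound_ends hG hs hS h4).mono le_rfl ?_
      exact fun ρ h => ⟨h.2, h.1.setVar (by omega)⟩
    · intro ρ hS
      refine ⟨hS.var_s, ⟨by simpa [Store.setVar] using hS.base.1,
        by simpa [Store.setVar] using hS.base.2.1, hS.base.2.2⟩, ?_, fun i hi => hS.after i hi⟩
      intro i hi v hv
      rcases Nat.lt_succ_iff_lt_or_eq.1 hi with hi | rfl
      · exact hS.before i hi v hv
      · exact (hS.sound v hv).resolve_left (hS.marked v hv (hG.dist_le hs hv))

end

/-! ### Exhaustive search for a vertex -/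

/-- Assign to `z` some `v < n` such that the condition `c` holds for `v` and some `w < n`. -/
def findProg (z : ℕ) (c : Expr) : Prog :=
  forAll 3 (forAll 4 (.ite c (.assign z (.var 3)) .skip))

theorem findProg_ends {n z : ℕ} {c : Expr} {K : Store → Prop} {P : ℕ → ℕ → Prop}
    (hz3 : z ≠ 3) (hz4 : z ≠ 4) (hK0 : ∀ τ, K τ → τ.var 0 = n)
    (hK : ∀ τ m, K τ → K (τ.setVar z m) ∧ K (τ.setVar 3 m) ∧ K (τ.setVar 4 m))
    (hc : ∀ τ, K τ → τ.var 3 < n → τ.var 4 < n → (c.eval τ ≠ 0 ↔ P (τ.var 3) (τ.var 4)))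
    (hP : ∃ v < n, ∃ w < n, P v w) {σ : Store} (hσ : K σ) :
    Ends (findProg z c) σ ((n + 1) * ((n + 1) * (c.cost + 11) + 10) + 2) fun τ =>
      K τ ∧ τ.var z < n ∧ ∃ w < n, P (τ.var z) w := by
  refine Ends.mono (Ends.forAll (n := n) (T := (n + 1) * (c.cost + 11) + 2)
    -- Later successes may overwrite `z`. The invariant only says that `z` is valid or that nothing
    -- has been found yet.
    (fun i τ => K τ ∧ ((τ.var z < n ∧ ∃ w < n, P (τ.var z) w) ∨ ∀ v < i, ∀ w < n, ¬ P v w))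
    (fun _ τ h => hK0 τ h.1) ⟨(hK _ 0 hσ).2.1, Or.inr fun v hv => absurd hv (by omega)⟩ ?_)
    le_rfl ?_
  · rintro i τ hi ⟨hτ, hor⟩ h3
    refine Ends.mono (Ends.forAll (n := n) (T := c.cost + 3)
      (fun j τ => K τ ∧ τ.var 3 = i ∧ ((τ.var z < n ∧ ∃ w < n, P (τ.var z) w) ∨
        (∀ v < i, ∀ w < n, ¬ P v w) ∧ ∀ w < j, ¬ P i w))
      (fun _ τ h => hK0 τ h.1) ⟨(hK _ 0 hτ).2.2, by simpa [Store.setVar] using h3, ?_⟩ ?_)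
      le_rfl ?_
    · have : (τ.setVar 4 0).var z = τ.var z := by simp [Store.setVar, hz4]
      rw [this]
      exact hor.imp_right fun h => ⟨h, fun w hw => absurd hw (by omega)⟩
    · rintro j τ hj ⟨hτ, h3, hor⟩ h4
      have hc' := hc τ hτ (by omega) (by omega)
      rw [h3, h4] at hc'
      refine (Ends.ite (T := 2) (fun he => Ends.assign ?_ (by simp [Expr.cost]))
        fun he => Ends.skip ?_ (by omega)).mono (by omega) fun _ h => h
      · refine ⟨by simpa [Store.setVar, hz4.symm] using h4, (hK _ _ (hK _ _ hτ).1).2.2,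
          by simpa [Store.setVar, hz3.symm] using h3, Or.inl ?_⟩
        have : ((τ.setVar z ((Expr.var 3).eval τ)).setVar 4 (j + 1)).var z = i := by
          simp [Store.setVar, hz4, Expr.eval, h3]
        rw [this]
        exact ⟨hi, j, hj, hc'.1 he⟩
      · refine ⟨h4, (hK _ _ hτ).2.2, by simpa [Store.setVar] using h3, ?_⟩
        have : (τ.setVar 4 (j + 1)).var z = τ.var z := by simp [Store.setVar, hz4]
        rw [this]
        refine hor.imp_right fun h => ⟨h.1, fun w hw => ?_⟩
        rcases Nat.lt_succ_iff_lt_or_eq.1 hw with hw | rfl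
        · exact h.2 w hw
        · exact fun hp => hc'.2 hp he
    · rintro ρ ⟨hρ, h3, hor⟩
      refine ⟨h3, (hK _ _ hρ).2.1, ?_⟩
      have : (ρ.setVar 3 (i + 1)).var z = ρ.var z := by simp [Store.setVar, hz3]
      rw [this]
      refine hor.imp_right fun h v hv w hw => ?_
      rcases Nat.lt_succ_iff_lt_or_eq.1 hv with hv | rfl
      · exact h.1 v hv w hw
      · exact h.2 w hw
  · rintro τ ⟨hτ, hor⟩
    refine ⟨hτ, hor.resolve_right fun h => ?_⟩
    obtain ⟨v, hv, w, hw, hp⟩ := hP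
    exact h v hv w hw hp

/-! ### Evaluating the hub recursion by a loop -/

/-- Swap the two coordinates and decrease the remaining depth. -/
def swapProg : Prog :=
  .seq (.assign 19 (.var 9)) <| .seq (.assign 9 (.var 11)) <| .seq (.assign 11 (.var 19)) <|
  .seq (.assign 19 (.var 10)) <| .seq (.assign 10 (.var 12)) <| .seq (.assign 12 (.var 19)) <|
  .seq (.assign 19 (.var 13)) <| .seq (.assign 13 (.var 14)) <| .seq (.assign 14 (.var 19)) <|
  .seq (.assign 19 (.var 15)) <| .seq (.assign 15 (.var 16)) <| .seq (.assign 16 (.var 19)) <|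
  .assign 17 (.sub (.var 17) (.const 1))

theorem Ends.assign_seq {x : ℕ} {e : Expr} {q : Prog} {σ : Store} {T : ℕ} {Q : Store → Prop}
    (h : Ends q (σ.setVar x (e.eval σ)) T Q) :
    Ends (.seq (.assign x e) q) σ (e.cost + 1 + T) Q :=
  Ends.seq (Ends.assign h le_rfl)

theorem swapProg_ends (σ : Store) :
    Ends swapProg σ 28 fun τ => τ.arr = σ.arr ∧ (∀ z < 9, τ.var z = σ.var z) ∧
      τ.var 9 = σ.var 11 ∧ τ.var 11 = σ.var 9 ∧ τ.var 10 = σ.var 12 ∧ τ.var 12 = σ.var 10 ∧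
      τ.var 13 = σ.var 14 ∧ τ.var 14 = σ.var 13 ∧ τ.var 15 = σ.var 16 ∧ τ.var 16 = σ.var 15 ∧
      τ.var 17 = σ.var 17 - 1 ∧ τ.var 18 = σ.var 18 := by
  unfold swapProg
  refine Ends.mono (T := 28) (Ends.assign_seq <| Ends.assign_seq <| Ends.assign_seq <|
    Ends.assign_seq <| Ends.assign_seq <| Ends.assign_seq <| Ends.assign_seq <|
    Ends.assign_seq <| Ends.assign_seq <| Ends.assign_seq <| Ends.assign_seq <|
    Ends.assign_seq <| Ends.assign (T := 4) ?_ le_rfl) le_rfl fun _ h => h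
  refine ⟨rfl, fun z hz => ?_, by simp [Store.setVar, Expr.eval]⟩
  interval_cases z <;> rfl

def haltProg : Prog := .assign 17 (.const 0)

def hitProg : Prog := .seq (.assign 18 (.add (.var 18) (.const 1))) haltProg

/-- One step of the recursion in `hub`, with the arguments in the variables `17`, `9`, …, `16`. -/
def hubStepProg : Prog :=
  .seq (.assign 2 (.half (.add (.var 9) (.var 10)))) <|
  .ite (.eq (.var 15) (.var 2))
    (.ite (.eq (.var 13) (.var 2)) (.ite (.lt (.var 16) (.var 14)) haltProg hitProg) hitProg)
    (.ite (.lt (.var 13) (.var 2))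
      (.ite (.lt (.var 15) (.var 2)) (.seq (.assign 10 (.var 2)) swapProg) haltProg)
      (.ite (.eq (.var 13) (.var 2)) haltProg
        (.ite (.lt (.var 15) (.var 2)) haltProg
          (.seq (.assign 9 (.add (.var 2) (.const 1))) swapProg))))

/-- The loop that computes `hub` is in a state with remaining depth `f`, final result `R`, the
arrays `arr` and protected variables `var`. -/
structure HubState (var : ℕ → ℕ) (arr : ℕ → ℕ → ℕ → ℕ) (R f : ℕ) (σ : Store) : Prop where
  fuel : σ.var 17 = f
  arr_eq : σ.arr = arr
  var_eq : ∀ z < 9, z ≠ 2 → σ.var z = var z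
  result : hub f (σ.var 9) (σ.var 10) (σ.var 11) (σ.var 12) (σ.var 13) (σ.var 14) (σ.var 15)
    (σ.var 16) + σ.var 18 = R

theorem Ends.iteProp {p q : Prog} {e : Expr} {σ : Store} {T : ℕ} {Q : Store → Prop} (c : Prop)
    [Decidable c] (he : e.eval σ = if c then 1 else 0)
    (h1 : c → Ends p σ T Q) (h2 : ¬ c → Ends q σ T Q) :
    Ends (.ite e p q) σ (e.cost + 1 + T) Q := by
  refine Ends.ite (fun h => h1 ?_) fun h => h2 ?_
  · by_contra hc
    simp [he, hc] at h
  · intro hc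
    simp [he, hc] at h

/-- `hub` is tail recursive: a pass either installs the arguments of the recursive call or sets the
depth to `0`, where `hub` vanishes and variable `18` must hold the result. The sum of both is
preserved. -/
theorem hubStepProg_ends {var : ℕ → ℕ} {arr : ℕ → ℕ → ℕ → ℕ} {R f : ℕ} {σ : Store}
    (h : HubState var arr R (f + 1) σ) :
    Ends hubStepProg σ 60 fun τ => ∃ g < f + 1, HubState var arr R g τ := by
  obtain ⟨h1, h2, h3, h4⟩ := h
  unfold hub at h4
  unfold hubStepProg
  refine (Ends.assign_seq (T := 54) ?_).mono (by simp [Expr.cost]) fun _ h => h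
  simp only [Expr.eval]
  generalize hτ : σ.setVar 2 ((σ.var 9 + σ.var 10) / 2) = τ
  have t2 : τ.var 2 = (σ.var 9 + σ.var 10) / 2 := by simp [← hτ, Store.setVar]
  have tz : ∀ z, z ≠ 2 → τ.var z = σ.var z := by
    intro z hz
    simp [← hτ, Store.setVar, hz]
  have ta : τ.arr = arr := by rw [← h2, ← hτ]; rfl
  rw [← t2, ← tz 9 (by omega), ← tz 10 (by omega), ← tz 11 (by omega), ← tz 12 (by omega),
    ← tz 13 (by omega), ← tz 14 (by omega), ← tz 15 (by omega), ← tz 16 (by omega),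
    ← tz 18 (by omega)] at h4
  rw [← tz 17 (by omega)] at h1
  replace h3 : ∀ z < 9, z ≠ 2 → τ.var z = var z := fun z hz hz' => (tz z hz').trans (h3 z hz hz')
  clear hτ t2 tz h2 σ
  have halt : τ.var 18 = R → Ends haltProg τ 38 fun τ => ∃ g < f + 1, HubState var arr R g τ := by
    intro hR
    refine Ends.assign ⟨0, by omega, by simp [Store.setVar, Expr.eval], ta, ?_, ?_⟩
      (by simp [Expr.cost])
    · intro z hz hz'
      rw [← h3 z hz hz']
      simp [Store.setVar, show z ≠ 17 by omega]
    · simpa [Store.setVar, hub] using hR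
  have hit : 1 + τ.var 18 = R →
      Ends hitProg τ 38 fun τ => ∃ g < f + 1, HubState var arr R g τ := by
    intro hR
    refine (Ends.assign_seq (T := 2) (Ends.assign ⟨0, by omega,
      by simp [Store.setVar, Expr.eval], ta, ?_, ?_⟩
      (by simp [Expr.cost]))).mono (by simp [Expr.cost]) fun _ h => h
    · intro z hz hz'
      rw [← h3 z hz hz']
      simp [Store.setVar, show z ≠ 17 by omega, show z ≠ 18 by omega]
    · simpa [Store.setVar, hub, Expr.eval, add_comm] using hR
  refine (Ends.iteProp (T := 50) (τ.var 15 = τ.var 2) rfl (fun c1 => ?_) fun c1 => ?_).mono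
    (by simp [Expr.cost]) fun _ h => h
  · rw [if_pos c1] at h4
    refine (Ends.iteProp (T := 46) (τ.var 13 = τ.var 2) rfl (fun c2 => ?_) fun c2 => ?_).mono
      (by simp [Expr.cost]) fun _ h => h
    · rw [if_pos c2] at h4
      refine (Ends.iteProp (T := 38) (τ.var 16 < τ.var 14) rfl (fun c3 => ?_) fun c3 => ?_).mono
        (by simp [Expr.cost]) fun _ h => h
      · rw [if_pos c3] at h4
        exact halt (by omega)
      · rw [if_neg c3] at h4
        exact hit h4
    · rw [if_neg c2] at h4
      exact (hit h4).mono (by omega) fun _ h => h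
  · rw [if_neg c1] at h4
    refine (Ends.iteProp (T := 46) (τ.var 13 < τ.var 2) rfl (fun c2 => ?_) fun c2 => ?_).mono
      (by simp [Expr.cost]) fun _ h => h
    · rw [if_pos c2] at h4
      refine (Ends.iteProp (T := 38) (τ.var 15 < τ.var 2) rfl (fun c3 => ?_) fun c3 => ?_).mono
        (by simp [Expr.cost]) fun _ h => h
      · rw [if_pos c3] at h4
        refine (Ends.assign_seq ((swapProg_ends _).mono le_rfl ?_)).mono (by simp [Expr.cost])
          fun _ h => h
        rintro ρ ⟨ra, rz, r9, r11, r10, r12, r13, r14, r15, r16, r17, r18⟩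
        simp only [Store.setVar, Expr.eval] at ra rz r9 r11 r10 r12 r13 r14 r15 r16 r17 r18
        refine ⟨f, by omega, by simp [r17, h1], ra.trans ta, ?_, ?_⟩
        · intro z hz hz'
          rw [rz z hz, if_neg (by omega), h3 z hz hz']
        · rw [r9, r10, r11, r12, r13, r14, r15, r16, r18]
          simpa using h4
      · rw [if_neg c3] at h4
        exact halt (by omega)
    · rw [if_neg c2] at h4
      refine (Ends.iteProp (T := 42) (τ.var 13 = τ.var 2) rfl (fun c3 => ?_) fun c3 => ?_).mono
        (by simp [Expr.cost]) fun _ h => h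
      · rw [if_pos c3] at h4
        exact (halt (by omega)).mono (by omega) fun _ h => h
      · rw [if_neg c3] at h4
        refine (Ends.iteProp (T := 38) (τ.var 15 < τ.var 2) rfl (fun c4 => ?_) fun c4 => ?_).mono
          (by simp [Expr.cost]) fun _ h => h
        · rw [if_pos c4] at h4
          exact halt (by omega)
        · rw [if_neg c4] at h4
          refine (Ends.assign_seq ((swapProg_ends _).mono le_rfl ?_)).mono (by simp [Expr.cost])
            fun _ h => h
          rintro ρ ⟨ra, rz, r9, r11, r10, r12, r13, r14, r15, r16, r17, r18⟩
          simp only [Store.setVar, Expr.eval] at ra rz r9 r11 r10 r12 r13 r14 r15 r16 r17 r18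
          refine ⟨f, by omega, by simp [r17, h1], ra.trans ta, ?_, ?_⟩
          · intro z hz hz'
            rw [rz z hz, if_neg (by omega), h3 z hz hz']
          · rw [r9, r10, r11, r12, r13, r14, r15, r16, r18]
            simpa using h4

theorem hubLoop_ends {var : ℕ → ℕ} {arr : ℕ → ℕ → ℕ → ℕ} {R f : ℕ} {σ : Store}
    (h : HubState var arr R f σ) :
    Ends (.loop (.var 17) hubStepProg) σ ((f + 1) * 62) fun τ =>
      τ.arr = arr ∧ (∀ z < 9, z ≠ 2 → τ.var z = var z) ∧ τ.var 18 = R := by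
  refine (Ends.loop (T := 60) (HubState var arr R) (fun f σ h he => ?_) h).mono
    (by simp [Expr.cost]) ?_
  · cases f with
    | zero => exact absurd h.fuel he
    | succ f => exact hubStepProg_ends h
  · rintro τ ⟨he, g, hg⟩
    obtain rfl : g = 0 := hg.fuel.symm.trans he
    exact ⟨hg.arr_eq, hg.var_eq, by simpa [hub] using hg.result⟩

/-! ### Corners and coordinates -/

/-- The variables `0`, `1` and the array `2` hold the number of vertices, the side length and the
distances plus one. -/
structure Measured (n k : ℕ) (x y : ℕ → ℕ) (σ : Store) : Prop where
  var_zero : σ.var 0 = n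
  var_one : σ.var 1 = k
  dist : ∀ i < n, ∀ v < n, σ.arr 2 i v = gridDist x y i v + 1

theorem Measured.setVar {n k z m : ℕ} {x y : ℕ → ℕ} {σ : Store} (h : Measured n k x y σ)
    (hz : 1 < z) : Measured n k x y (σ.setVar z m) :=
  ⟨by simpa [Store.setVar, show 0 ≠ z by omega] using h.var_zero,
    by simpa [Store.setVar, show 1 ≠ z by omega] using h.var_one, h.dist⟩

/-- First coordinate of `i`, computed from the distances to the corners `p` and `q`. -/
def cornerX (k : ℕ) (x y : ℕ → ℕ) (p q i : ℕ) : ℕ :=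
  (gridDist x y p i + 1 + k - (gridDist x y q i + 1 + 1)) / 2

/-- Second coordinate of `i`, computed from the distances to the corners `p` and `q`. -/
def cornerY (k : ℕ) (x y : ℕ → ℕ) (p q i : ℕ) : ℕ :=
  (gridDist x y p i + 1 + (gridDist x y q i + 1) - (k + 1)) / 2

/-- `p` and `q` are corners at the two ends of a side. -/
def AdjacentCorners (n k : ℕ) (x y : ℕ → ℕ) (p q : ℕ) : Prop :=
  p < n ∧ q < n ∧ (∃ w < n, gridDist x y p w + 2 = k + k) ∧
    (∃ w < n, gridDist x y q w + 2 = k + k) ∧ gridDist x y p q + 1 = k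

section

variable {n k : ℕ} {A : ℕ → ℕ → ℕ} {x y : ℕ → ℕ}

theorem GridMatrix.corner (h : GridMatrix n k A x y) {p : ℕ} (hp : p < n)
    (hw : ∃ w < n, gridDist x y p w + 2 = k + k) :
    (x p = 0 ∨ x p + 1 = k) ∧ (y p = 0 ∨ y p + 1 = k) := by
  obtain ⟨w, hw, hd⟩ := hw
  have h1 := h.x_lt p hp
  have h2 := h.y_lt p hp
  have h3 := h.x_lt w hw
  have h4 := h.y_lt w hw
  unfold gridDist at hd
  omega

/-- The distances from `c` to the two ends of a side sum to `k - 1`, and `D` is the common distance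
in the other direction. Half the shifted difference and half the shifted sum recover both;
truncation loses nothing. -/
theorem dist_ends {k s t c D : ℕ} (hs : s = 0 ∧ t + 1 = k ∨ s + 1 = k ∧ t = 0) (hc : c < k) :
    ((s - c + (c - s)) + D + 1 + k - ((t - c + (c - t)) + D + 1 + 1)) / 2 = s - c + (c - s) ∧
    ((s - c + (c - s)) + D + 1 + ((t - c + (c - t)) + D + 1) - (k + 1)) / 2 = D := by
  have e : (s - c + (c - s)) + (t - c + (c - t)) + 1 = k := by omega
  generalize s - c + (c - s) = a at *
  generalize t - c + (c - t) = b at *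
  omega

/-- The computed coordinates are the given ones up to a symmetry of the square. -/
theorem GridMatrix.cornerXY_eq (h : GridMatrix n k A x y) {p q : ℕ}
    (hc : AdjacentCorners n k x y p q) :
    ∃ a b : ℕ → ℕ, (a = x ∧ b = y ∨ a = y ∧ b = x) ∧
      ((∀ i < n, cornerX k x y p q i = a i) ∨ ∀ i < n, cornerX k x y p q i + a i + 1 = k) ∧
      ((∀ i < n, cornerY k x y p q i = b i) ∨ ∀ i < n, cornerY k x y p q i + b i + 1 = k) := by
  obtain ⟨hp, hq, hp', hq', hd⟩ := hc
  obtain ⟨hpx, hpy⟩ := h.corner hp hp'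
  obtain ⟨hqx, hqy⟩ := h.corner hq hq'
  have abs_eq {s : ℕ} {z : ℕ → ℕ} (hz : ∀ i < n, z i < k) (hs : s = 0 ∨ s + 1 = k) :
      (∀ i < n, s - z i + (z i - s) = z i) ∨ ∀ i < n, s - z i + (z i - s) + z i + 1 = k := by
    refine hs.imp (fun e i hi => ?_) fun e i hi => ?_ <;>
    · have := hz i hi
      omega
  unfold gridDist at hd
  -- Corners at distance `k - 1` agree in one coordinate and lie at opposite ends in the other;
  -- which one decides whether the axes are swapped. For `k = 1` the first case applies with `p =
  -- q`.
  by_cases hy : y p = y q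
  · have hx : x p = 0 ∧ x q + 1 = k ∨ x p + 1 = k ∧ x q = 0 := by
      rw [hy] at hd
      omega
    have key (i : ℕ) (hi : i < n) := dist_ends (D := y p - y i + (y i - y p)) hx (h.x_lt i hi)
    refine ⟨x, y, Or.inl ⟨rfl, rfl⟩, ?_, ?_⟩
    · refine (abs_eq h.x_lt hpx).imp (fun e i hi => ?_) fun e i hi => ?_ <;>
      · rw [cornerX, gridDist, gridDist, ← hy, (key i hi).1, e i hi]
    · refine (abs_eq h.y_lt hpy).imp (fun e i hi => ?_) fun e i hi => ?_ <;>
      · rw [cornerY, gridDist, gridDist, ← hy, (key i hi).2, e i hi]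
  · have hx : x p = x q := by omega
    have hy : y p = 0 ∧ y q + 1 = k ∨ y p + 1 = k ∧ y q = 0 := by omega
    have key (i : ℕ) (hi : i < n) := dist_ends (D := x p - x i + (x i - x p)) hy (h.y_lt i hi)
    refine ⟨y, x, Or.inr ⟨rfl, rfl⟩, ?_, ?_⟩
    · refine (abs_eq h.y_lt hpy).imp (fun e i hi => ?_) fun e i hi => ?_ <;>
      · rw [cornerX, gridDist, gridDist, ← hx, add_comm (x p - x i + _),
          add_comm (x p - x i + _), (key i hi).1, e i hi]
    · refine (abs_eq h.x_lt hpx).imp (fun e i hi => ?_) fun e i hi => ?_ <;>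
      · rw [cornerY, gridDist, gridDist, ← hx, add_comm (x p - x i + _),
          add_comm (x p - x i + _), (key i hi).2, e i hi]

/-- The computed coordinates are bounded, injective, and change by at most one along an edge. -/
theorem GridMatrix.cornerXY_spec (h : GridMatrix n k A x y) {p q : ℕ}
    (hc : AdjacentCorners n k x y p q) {i j : ℕ} (hi : i < n) (hj : j < n) :
    cornerX k x y p q i < k ∧ cornerY k x y p q i < k ∧
    (cornerX k x y p q i = cornerX k x y p q j → cornerY k x y p q i = cornerY k x y p q j →
      x i = x j ∧ y i = y j) ∧
    (gridDist x y i j = 1 → cornerX k x y p q i ≤ cornerX k x y p q j + 1 ∧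
      cornerY k x y p q i ≤ cornerY k x y p q j + 1) := by
  have h1 := h.x_lt i hi
  have h2 := h.y_lt i hi
  obtain ⟨a, b, hab, hX, hY⟩ := h.cornerXY_eq hc
  have hX' : cornerX k x y p q i = a i ∧ cornerX k x y p q j = a j ∨
      cornerX k x y p q i + a i + 1 = k ∧ cornerX k x y p q j + a j + 1 = k :=
    hX.imp (fun h => ⟨h i hi, h j hj⟩) fun h => ⟨h i hi, h j hj⟩
  have hY' : cornerY k x y p q i = b i ∧ cornerY k x y p q j = b j ∨
      cornerY k x y p q i + b i + 1 = k ∧ cornerY k x y p q j + b j + 1 = k :=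
    hY.imp (fun h => ⟨h i hi, h j hj⟩) fun h => ⟨h i hi, h j hj⟩
  clear hX hY
  unfold gridDist
  rcases hab with ⟨rfl, rfl⟩ | ⟨rfl, rfl⟩ <;> refine ⟨?_, ?_, ?_, ?_⟩ <;> omega

theorem GridMatrix.exists_corner (h : GridMatrix n k A x y) :
    ∃ v < n, ∃ w < n, gridDist x y v w + 2 = k + k := by
  have := h.pos
  obtain ⟨v, hv, h1, h2⟩ := h.surj 0 h.pos 0 h.pos
  obtain ⟨w, hw, h3, h4⟩ := h.surj (k - 1) (by omega) (k - 1) (by omega)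
  refine ⟨v, hv, w, hw, ?_⟩
  unfold gridDist
  omega

/-- Reflecting `p` in the first coordinate gives `v`; reflecting it in the second gives the corner
opposite to `v`, which witnesses that `v` is a corner. -/
theorem GridMatrix.exists_adjacent_corner (h : GridMatrix n k A x y) {p : ℕ} (hp : p < n)
    (hw : ∃ w < n, gridDist x y p w + 2 = k + k) :
    ∃ v < n, ∃ w < n, gridDist x y v w + 2 = k + k ∧ gridDist x y p v + 1 = k := by
  have := h.pos
  have hx := h.x_lt p hp
  have hy := h.y_lt p hp
  have hc := h.corner hp hw
  obtain ⟨v, hv, h1, h2⟩ := h.surj (k - 1 - x p) (by omega) (y p) (by omega)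
  obtain ⟨w, hw, h3, h4⟩ := h.surj (x p) (by omega) (k - 1 - y p) (by omega)
  refine ⟨v, hv, w, hw, ?_⟩
  unfold gridDist
  omega

end

def cornerCond : Expr :=
  .eq (.add (.get 2 (.var 3) (.var 4)) (.const 1)) (.add (.var 1) (.var 1))

/-- A conjunction, expressed by two truth values having a sum greater than `1`. -/
def adjacentCornerCond : Expr :=
  .lt (.const 1) (.add cornerCond (.eq (.get 2 (.var 7) (.var 3)) (.var 1)))

section

variable {n k : ℕ} {A : ℕ → ℕ → ℕ} {x y : ℕ → ℕ}

theorem cornerCond_eval {τ : Store} (h : Measured n k x y τ) (h3 : τ.var 3 < n) (h4 : τ.var 4 < n) :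
    cornerCond.eval τ = if gridDist x y (τ.var 3) (τ.var 4) + 2 = k + k then 1 else 0 := by
  simp [cornerCond, Expr.eval, h.dist _ h3 _ h4, h.var_one]

theorem cornersProg_ends (hG : GridMatrix n k A x y) {σ : Store} (hσ : Measured n k x y σ) :
    Ends (.seq (findProg 7 cornerCond) (findProg 8 adjacentCornerCond)) σ
      (2 * ((n + 1) * ((n + 1) * 30 + 10) + 2)) fun τ => Measured n k x y τ ∧
        AdjacentCorners n k x y (τ.var 7) (τ.var 8) := by
  rw [two_mul]
  refine Ends.seq ((findProg_ends (n := n) (K := Measured n k x y)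
    (P := fun v w => gridDist x y v w + 2 = k + k) (by omega) (by omega)
    (fun τ h => h.var_zero)
    (fun τ m h => ⟨h.setVar (by omega), h.setVar (by omega), h.setVar (by omega)⟩) ?_
    hG.exists_corner hσ).mono ?_ ?_)
  · intro τ h h3 h4
    rw [cornerCond_eval h h3 h4]
    split_ifs with hc <;> simp [hc]
  · gcongr
    simp [cornerCond, Expr.cost]
  · rintro τ ⟨hτ, hp, hw⟩
    obtain ⟨p, h7⟩ : ∃ p, τ.var 7 = p := ⟨_, rfl⟩
    rw [h7] at hp hw
    refine (findProg_ends (n := n) (K := fun τ => Measured n k x y τ ∧ τ.var 7 = p)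
      (P := fun v w => gridDist x y v w + 2 = k + k ∧ gridDist x y p v + 1 = k)
      (by omega) (by omega) (fun τ h => h.1.var_zero)
      (fun τ m h => ⟨⟨h.1.setVar (by omega), by simpa [Store.setVar] using h.2⟩,
        ⟨h.1.setVar (by omega), by simpa [Store.setVar] using h.2⟩,
        ⟨h.1.setVar (by omega), by simpa [Store.setVar] using h.2⟩⟩) ?_
      (hG.exists_adjacent_corner hp hw) ⟨hτ, h7⟩).mono ?_ ?_
    · rintro ρ ⟨h, h7⟩ h3 h4
      have : adjacentCornerCond.eval ρ = if 1 < cornerCond.eval ρ +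
          (if gridDist x y p (ρ.var 3) + 1 = k then 1 else 0) then 1 else 0 := by
        simp [adjacentCornerCond, Expr.eval, h7, h.dist _ hp _ h3, h.var_one]
      rw [this, cornerCond_eval h h3 h4]
      split_ifs <;> simp_all
    · gcongr
      simp [cornerCond, adjacentCornerCond, Expr.cost]
    · rintro ρ ⟨⟨hρ, h7⟩, hq, w, hw', hd⟩
      rw [h7]
      exact ⟨hρ, hp, hq, hw, ⟨w, hw', hd.1⟩, hd.2⟩

end

/-! ### Writing the labels -/

def xExpr (z : ℕ) : Expr :=
  .half (.sub (.add (.get 2 (.var 7) (.var z)) (.var 1))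
    (.add (.get 2 (.var 8) (.var z)) (.const 1)))

def yExpr (z : ℕ) : Expr :=
  .half (.sub (.add (.get 2 (.var 7) (.var z)) (.get 2 (.var 8) (.var z)))
    (.add (.var 1) (.const 1)))

/-- Decide whether vertex `4` is a hub of vertex `3`. -/
def pairProg : Prog :=
  .seq (.assign 9 (.const 0)) <| .seq (.assign 10 (.var 1)) <|
  .seq (.assign 11 (.const 0)) <| .seq (.assign 12 (.var 1)) <|
  .seq (.assign 13 (xExpr 3)) <| .seq (.assign 14 (yExpr 3)) <|
  .seq (.assign 15 (xExpr 4)) <| .seq (.assign 16 (yExpr 4)) <|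
  .seq (.assign 17 (.add (.var 1) (.var 1))) <| .seq (.assign 18 (.const 0)) <|
  .seq (.loop (.var 17) hubStepProg) (.store 1 (.var 3) (.var 4) (.var 18))

def labelProg : Prog := forAll 3 (forAll 4 pairProg)

section

variable {n k : ℕ} {A : ℕ → ℕ → ℕ} {x y : ℕ → ℕ}

theorem pairProg_ends {p q u v : ℕ} (hp : p < n) (hq : q < n) (hv : v < n) (hu : u < n) {σ : Store}
    (hσ : Measured n k x y σ) (h7 : σ.var 7 = p) (h8 : σ.var 8 = q) (h3 : σ.var 3 = v)
    (h4 : σ.var 4 = u) :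
    Ends pairProg σ (100 + ((k + k + 1) * 62 + 4)) fun τ =>
      (∀ z < 9, z ≠ 2 → τ.var z = σ.var z) ∧
      τ.arr = (σ.setArr 1 v u (hub (k + k) 0 k 0 k (cornerX k x y p q v) (cornerY k x y p q v)
        (cornerX k x y p q u) (cornerY k x y p q u))).arr := by
  unfold pairProg
  refine Ends.mono (Ends.assign_seq <| Ends.assign_seq <| Ends.assign_seq <|
    Ends.assign_seq <| Ends.assign_seq <| Ends.assign_seq <| Ends.assign_seq <|
    Ends.assign_seq <| Ends.assign_seq <| Ends.assign_seq <|
    Ends.seq (T₁ := (k + k + 1) * 62) (T₂ := 4) ?_) (by simp [Expr.cost, xExpr, yExpr]; omega)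
    fun _ h => h
  refine (hubLoop_ends (var := σ.var) (arr := σ.arr)
    (R := hub (k + k) 0 k 0 k (cornerX k x y p q v) (cornerY k x y p q v)
        (cornerX k x y p q u) (cornerY k x y p q u)) ⟨?_, ?_, ?_, ?_⟩).mono le_rfl ?_
  · simp [Store.setVar, Expr.eval, hσ.var_one]
  · rfl
  · intro z hz hz'
    interval_cases z <;> rfl
  · simp [Store.setVar, Expr.eval, xExpr, yExpr, hσ.var_one, h7, h8, h3, h4, hσ.dist p hp v hv,
      hσ.dist p hp u hu, hσ.dist q hq v hv, hσ.dist q hq u hu, cornerX, cornerY]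
  · rintro τ ⟨ha, hz, hR⟩
    refine Ends.store ⟨hz, ?_⟩ (by simp [Expr.cost])
    simp [Store.setArr, Expr.eval, ha, hR, hz 3, hz 4, h3, h4]

theorem labelProg_ends {σ : Store} {p q : ℕ} (hp : p < n) (hq : q < n) (hσ : Measured n k x y σ)
    (h7 : σ.var 7 = p) (h8 : σ.var 8 = q) :
    Ends labelProg σ ((n + 1) * ((n + 1) * (100 + ((k + k + 1) * 62 + 4) + 8) + 2 + 8) + 2)
      fun τ => ∀ v < n, ∀ u < n, τ.arr 1 v u =
        hub (k + k) 0 k 0 k (cornerX k x y p q v) (cornerY k x y p q v)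
          (cornerX k x y p q u) (cornerY k x y p q u) := by
  set H : ℕ → ℕ → ℕ := fun v u => hub (k + k) 0 k 0 k (cornerX k x y p q v)
    (cornerY k x y p q v) (cornerX k x y p q u) (cornerY k x y p q u)
  refine Ends.mono (Ends.forAll (n := n)
    (fun i τ => Measured n k x y τ ∧ τ.var 7 = p ∧ τ.var 8 = q ∧
      ∀ v < i, ∀ u < n, τ.arr 1 v u = H v u) (fun _ τ h => h.1.var_zero) ?_ ?_) le_rfl
      fun τ h => h.2.2.2
  · exact ⟨hσ.setVar (by omega), by simpa [Store.setVar] using h7,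
      by simpa [Store.setVar] using h8, fun v hv => absurd hv (by omega)⟩
  · rintro i τ hi ⟨hτ, h7, h8, hH⟩ h3
    refine Ends.mono (Ends.forAll (n := n) (T := 100 + ((k + k + 1) * 62 + 4))
      (fun j τ => Measured n k x y τ ∧ τ.var 7 = p ∧ τ.var 8 = q ∧ τ.var 3 = i ∧
        (∀ v < i, ∀ u < n, τ.arr 1 v u = H v u) ∧ ∀ u < j, τ.arr 1 i u = H i u)
      (fun _ τ h => h.1.var_zero) ?_ ?_) le_rfl ?_
    · exact ⟨hτ.setVar (by omega), by simpa [Store.setVar] using h7,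
        by simpa [Store.setVar] using h8, by simpa [Store.setVar] using h3, hH,
        fun v hv => absurd hv (by omega)⟩
    · rintro j τ hj ⟨hτ, h7, h8, h3, hH, hj'⟩ h4
      refine (pairProg_ends hp hq hi hj hτ h7 h8 h3 h4).mono le_rfl ?_
      rintro ρ ⟨hz, ha⟩
      have hval : ∀ v u, ρ.arr 1 v u = if v = i ∧ u = j then H i j else τ.arr 1 v u := by
        intro v u
        simp [ha, Store.setArr, H]
      have hM : Measured n k x y ρ :=
        ⟨(hz 0 (by omega) (by omega)).trans hτ.var_zero,
          (hz 1 (by omega) (by omega)).trans hτ.var_one, fun v hv u hu => by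
            simpa [ha, Store.setArr] using hτ.dist v hv u hu⟩
      refine ⟨(hz 4 (by omega) (by omega)).trans h4, hM.setVar (by omega), ?_, ?_, ?_, ?_, ?_⟩
      · simpa [Store.setVar, hz 7] using h7
      · simpa [Store.setVar, hz 8] using h8
      · simpa [Store.setVar, hz 3] using h3
      · intro v hv u hu
        refine (hval v u).trans ?_
        rw [if_neg (by omega), hH v hv u hu]
      · intro u hu
        refine (hval i u).trans ?_
        split_ifs with hc
        · rw [hc.2]
        · exact hj' u (by omega)
    · rintro ρ ⟨hρ, h7, h8, h3, hH, hj⟩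
      refine ⟨h3, hρ.setVar (by omega), by simpa [Store.setVar] using h7,
        by simpa [Store.setVar] using h8, fun v hv u hu => ?_⟩
      rcases Nat.lt_succ_iff_lt_or_eq.1 hv with hv | rfl
      · exact hH v hv u hu
      · exact hj u hu

end

/-! ### The complete algorithm and the approximation ratios -/

/-- Computes the nested dissection labeling of a square grid. -/
def gridLabelingProg : Prog :=
  .seq sideProg <| .seq distProg <|
    .seq (.seq (findProg 7 cornerCond) (findProg 8 adjacentCornerCond)) labelProg

theorem gridGraph_adj_iff {k : ℕ} (u v : Fin k × Fin k) :
    (gridGraph k).Adj u v ↔ ((u.1 : ℕ) - v.1) + ((v.1 : ℕ) - u.1) +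
      (((u.2 : ℕ) - v.2) + ((v.2 : ℕ) - u.2)) = 1 := by
  simp only [gridGraph, SimpleGraph.boxProd_adj, SimpleGraph.pathGraph_adj, Fin.ext_iff]
  omega

theorem exists_gridMatrix {n k : ℕ} (hn : 0 < n) {G : SimpleGraph (Fin n)}
    (φ : G ≃g gridGraph k) :
    ∃ x y : ℕ → ℕ, GridMatrix n k ((inputStore G).arr 0) x y := by
  have hcard : n = k * k := by
    have := Fintype.card_congr φ.toEquiv
    rwa [Fintype.card_prod, Fintype.card_fin, Fintype.card_fin] at this
  -- The default value `0` is never inspected, as `GridMatrix` only concerns indices below `n`.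
  refine ⟨fun i => if h : i < n then (φ ⟨i, h⟩).1 else 0,
    fun i => if h : i < n then (φ ⟨i, h⟩).2 else 0, hcard, ?_, ?_, ?_, ?_, ?_, ?_⟩
  · exact Nat.pos_of_ne_zero fun h => by simp [h] at hcard; omega
  · intro i hi
    simp [hi]
  · intro i hi
    simp [hi]
  · intro i hi j hj h1 h2
    simp only [hi, hj, dif_pos] at h1 h2
    have := φ.injective (Prod.ext (Fin.ext h1) (Fin.ext h2))
    simpa using this
  · intro a ha b hb
    refine ⟨φ.symm (⟨a, ha⟩, ⟨b, hb⟩), Fin.is_lt _, ?_⟩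
    simp
  · intro i hi j hj
    have h1 : (inputStore G).arr 0 i j ≠ 0 ↔ G.Adj ⟨i, hi⟩ ⟨j, hj⟩ := by
      simp [inputStore, hi, hj]
    rw [h1, ← φ.map_adj_iff, gridGraph_adj_iff]
    simp only [gridDist, hi, hj, dif_pos]

/-- A bound on the running time of `gridLabelingProg`. -/
noncomputable def gridLabelingTime : Polynomial ℕ :=
  let X' : Polynomial ℕ := Polynomial.X + 1
  X' * 16 + ((X' * (4 + (X' * (X' * (X' * 48 + 10) + 10) + 2) + 8) + 2) +
    (2 * (X' * (X' * 30 + 10) + 2) +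
      (X' * (X' * (100 + ((Polynomial.X + X') * 62 + 4) + 8) + 2 + 8) + 2)))

theorem gridLabelingProg_ends {n k : ℕ} {G : SimpleGraph (Fin n)} {x y : ℕ → ℕ}
    (hG : GridMatrix n k ((inputStore G).arr 0) x y) :
    Ends gridLabelingProg (inputStore G) (gridLabelingTime.eval n) fun τ =>
      ∃ p q, AdjacentCorners n k x y p q ∧ outputLabeling n τ =
        hubLabeling k (fun v => cornerX k x y p q v) (fun v => cornerY k x y p q v) := by
  -- Some time bounds involve the side length; this makes them polynomial in `n` alone.
  have hkn : k ≤ n := by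
    rw [hG.card_eq]
    exact Nat.le_mul_self k
  have hT : gridLabelingTime.eval n = (n + 1) * 16 +
      (((n + 1) * (4 + ((n + 1) * ((n + 1) * ((n + 1) * 48 + 10) + 10) + 2) + 8) + 2) +
      (2 * ((n + 1) * ((n + 1) * 30 + 10) + 2) +
      ((n + 1) * ((n + 1) * (100 + ((n + (n + 1)) * 62 + 4) + 8) + 2 + 8) + 2))) := by
    simp [gridLabelingTime]
  rw [hT]
  refine Ends.seq ((sideProg_ends (k := k) ?_ ?_ ?_).mono (by gcongr) ?_)
  · simp [inputStore, ← hG.card_eq]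
  · simp [inputStore]
  · simp [inputStore]
  rintro τ ⟨h0, h1, ha⟩
  refine Ends.seq ((distProg_ends hG ⟨h0.trans hG.card_eq.symm, h1, by rw [ha]⟩ ?_).mono
    le_rfl ?_)
  · intro i v
    rw [ha]
    simp [inputStore]
  rintro τ ⟨hb, hd⟩
  refine Ends.seq ((cornersProg_ends hG ⟨hb.1, hb.2.1, hd⟩).mono le_rfl ?_)
  rintro τ ⟨hM, hc⟩
  refine (labelProg_ends hc.1 hc.2.1 hM rfl rfl).mono (by rw [← add_assoc n n 1]; gcongr)
    fun ρ hρ => ?_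
  refine ⟨_, _, hc, ?_⟩
  funext v
  ext u
  simp [outputLabeling, hubLabeling, hρ v v.is_lt u u.is_lt]

end CuHL

theorem mainTheorem12 :
    ∃ (prog : CuHL.Prog) (T : Polynomial ℕ),
      ∀ (n : ℕ), 0 < n → ∀ G : SimpleGraph (Fin n), CuHL.IsSquareGrid G →
        ∃ (t : ℕ) (σ : CuHL.Store),
          CuHL.Run prog (CuHL.inputStore G) t σ ∧ t ≤ T.eval n ∧
          CuHL.IsHCuHL G (CuHL.outputLabeling n σ) ∧
          (∀ L : Fin n → Finset (Fin n), CuHL.IsCuHL G L →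
            CuHL.avgLabelSize (CuHL.outputLabeling n σ) ≤
              3 / ((1 / 4) * Real.sqrt (2 / 3)) * CuHL.avgLabelSize L) ∧
          (∀ L : Fin n → Finset (Fin n), CuHL.IsHCuHL G L →
            CuHL.avgLabelSize (CuHL.outputLabeling n σ) ≤
              3 / ((2 / 3) * Real.sqrt (2 / 3)) * CuHL.avgLabelSize L) := by
  refine ⟨CuHL.gridLabelingProg, CuHL.gridLabelingTime, fun n hn G hG => ?_⟩
  obtain ⟨k, ⟨φ⟩⟩ := hG
  obtain ⟨x, y, hM⟩ := CuHL.exists_gridMatrix hn φ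
  obtain ⟨t, σ, hrun, ht, p, q, hc, hout⟩ := CuHL.gridLabelingProg_ends hM
  have hX (v : Fin n) := (hM.cornerXY_spec hc v.is_lt v.is_lt).1
  have hY (v : Fin n) := (hM.cornerXY_spec hc v.is_lt v.is_lt).2.1
  have hinj (u v : Fin n) (h1 : CuHL.cornerX k x y p q u = CuHL.cornerX k x y p q v)
      (h2 : CuHL.cornerY k x y p q u = CuHL.cornerY k x y p q v) : u = v := by
    obtain ⟨e1, e2⟩ := (hM.cornerXY_spec hc u.is_lt v.is_lt).2.2.1 h1 h2
    exact Fin.ext (hM.inj u u.is_lt v v.is_lt e1 e2)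
  have hadj (u v : Fin n) (h : G.Adj u v) : CuHL.gridDist x y u v = 1 :=
    (hM.adj u u.is_lt v v.is_lt).1 (by simpa [CuHL.inputStore] using h)
  have hle : CuHL.avgLabelSize (CuHL.outputLabeling n σ) ≤ 3 * k := by
    rw [hout]
    exact CuHL.avgLabelSize_hubLabeling_le hX hY hinj
  have hθ : 0 < √(2 / 3 : ℝ) := Real.sqrt_pos.2 (by norm_num)
  -- Any constant up to `2 / 3` works for every customizable labeling; the two claims use `1 / 4`
  -- and `2 / 3`.
  have key {c : ℝ} (hc0 : 0 < c) (hc1 : c ≤ 2 / 3) (L : Fin n → Finset (Fin n))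
      (hL : CuHL.IsCuHL G L) : CuHL.avgLabelSize (CuHL.outputLabeling n σ) ≤
        3 / (c * √(2 / 3)) * CuHL.avgLabelSize L := by
    have hge : c * √(2 / 3) * k ≤ CuHL.avgLabelSize L :=
      le_trans (by gcongr) (CuHL.avgLabelSize_ge_of_iso hM.pos φ hL)
    refine hle.trans ?_
    rw [div_mul_eq_mul_div, le_div_iff₀ (by positivity)]
    linarith
  refine ⟨t, σ, hrun, ht, ?_, fun L hL => key (by norm_num) (by norm_num) L hL,
    fun L hL => key (by norm_num) le_rfl L hL.1⟩
  rw [hout]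
  exact CuHL.isHCuHL_hubLabeling hX hY hinj
    (fun u v h => ((hM.cornerXY_spec hc u.is_lt v.is_lt).2.2.2 (hadj u v h)).1)
    (fun u v h => ((hM.cornerXY_spec hc u.is_lt v.is_lt).2.2.2 (hadj u v h)).2)
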